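/- **Setting.** For real $u\in L^2(\mathbb R)$ let $(-\Delta)^{1/4}u$ be the function whose Fourier transform is $|\xi|^{1/2}\hat u(\xi)$ ($\xi$ the angular frequency), and let $$H^{1/2,2}(\mathbb R)=\{u\in L^2(\mathbb R):(-\Delta)^{1/4}u\in L^2(\mathbb R)\},\qquad \langle u,v\rangle_{1/2}=\int_{\mathbb R}(-\Delta)^{1/4}u\,(-\Delta)^{1/4}v\,dx+\int_{\mathbb R}uv\,dx,$$ with $\|u\|_{1/2}^2=\langle u,u\rangle_{1/2}$. Put $\mathbb H=H^{1/2,2}(\mathbb R)\times H^{1/2,2}(\mathbb R)$ and $\mathbb H^-=\{(u,-u):u\in H^{1/2,2}(\mathbb R)\}$. **Assumptions.** Let $P,Q:\mathbb R\to[0,\infty)$ be continuous with $\lim_{|x|\to\infty}P(x)=\lim_{|x|\to\infty}Q(x)=0$ and $\sqrt{P(0)Q(0)}=1$. Let $\alpha_0>0$ and $\theta>2$, and let each $h\in\{f,g\}$ satisfy: - critical growth at $+\infty$: $\lim_{s\to+\infty}\dfrac{h(s)}{e^{\alpha s^2}-1}$ equals $0$ if $\alpha>\alpha_0$, and $+\infty$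 if $0<\alpha<\alpha_0$; - (H1) $h:\mathbb R\to[0,\infty)$ is continuous, and $h(t)=0$ for all $t\le 0$; - (H2) $h(t)=o(t)$ as $t\to0$; - (H3) $0<\theta\int_0^t h(s)\,ds\le t\,h(t)$ for all $t>0$; - (H4) $\lim_{t\to+\infty}t\,h(t)e^{-\alpha_0t^2}=+\infty$. Write $F(t)=\int_0^tf(s)\,ds$, $G(t)=\int_0^tg(s)\,ds$, and for $(u,v)\in\mathbb H$ $$I(u,v)=\langle u,v\rangle_{1/2}-\int_{\mathbb R}P(x)F(u)\,dx-\int_{\mathbb R}Q(x)G(v)\,dx .$$ For integers $l\ge2$ let $m_l=\overline\omega_l/\|\overline\omega_l\|_{1/2}$, where $$\overline\omega_l(x)=\frac1{\sqrt\pi}\begin{cases}(\log l)^{1/2},&|x|\le 1/l,\\[2pt] \dfrac{\log(1/|x|)}{(\log l)^{1/2}},&1/l\le|x|\le1,\\[4pt] 0,&|x|\ge1.\end{cases}$$ **Proposition 3.3.** There exists $l_0\in\mathbb N$ such that for every $l\ge l_0$ one has $m_l\in H^{1/2,2}(\mathbb R)$ and $$\sup_{\mathbb R^+(m_l,m_l)\oplus\mathbb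 H^-}I<\frac{\pi}{\alpha_0},$$ where $\mathbb R^+(m_l,m_l)\oplus\mathbb H^-=\{t(m_l,m_l)+(u,-u):t\ge0,\ u\in H^{1/2,2}(\mathbb R)\}$ (in particular, $I$ is bounded above on this set). -/

import Mathlib

open MeasureTheory Filter Topology

noncomputable section

namespace FracHamiltonian

/-- The `L²` Fourier transform of a real function `u ∈ L²(ℝ)`, in Mathlib's normalisation
`û(ξ) = ∫ e^{-2πi x ξ} u(x) dx` (it is `0` if `u` is not in `L²`). -/
def fourierL2 (u : ℝ → ℝ) : ℝ → ℂ :=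
  open Classical in
  if hu : MemLp (fun x => (u x : ℂ)) 2 (volume : Measure ℝ) then
    ⇑(Lp.fourierTransformₗᵢ ℝ ℂ hu.toLp)
  else 0

/-- The function `|2πξ|^{1/2} û(ξ)`, i.e. the Fourier transform of `(-Δ)^{1/4} u`: in the above
normalisation `-Δ` has the symbol `|2πξ|²`. -/
def quarterSymbolMul (u : ℝ → ℝ) : ℝ → ℂ :=
  fun ξ => ((|2 * Real.pi * ξ| ^ (1 / 2 : ℝ) : ℝ) : ℂ) * fourierL2 u ξ

/-- The Bessel potential space `H^{1/2,2}(ℝ) = {u ∈ L²(ℝ) : (-Δ)^{1/4} u ∈ L²(ℝ)}` of real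
functions. By Plancherel, `(-Δ)^{1/4} u ∈ L²` means that its Fourier transform is in `L²`. -/
def HHalf : Set (ℝ → ℝ) :=
  {u | MemLp u 2 (volume : Measure ℝ) ∧ MemLp (quarterSymbolMul u) 2 (volume : Measure ℝ)}

/-- `(-Δ)^{1/4} u` for `u ∈ H^{1/2,2}(ℝ)`, the inverse `L²` Fourier transform of
`|2πξ|^{1/2} û(ξ)`. For a real `u` that inverse transform is real-valued almost everywhere (the
symbol is real and even), so taking real parts only changes the codomain. -/
def quarterLaplacian (u : ℝ → ℝ) : ℝ → ℝ :=
  open Classical in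
  if hu : MemLp (quarterSymbolMul u) 2 (volume : Measure ℝ) then
    fun x => (((Lp.fourierTransformₗᵢ ℝ ℂ).symm hu.toLp : Lp ℂ 2 (volume : Measure ℝ)) x).re
  else 0

/-- The inner product `⟨u, v⟩_{1/2}` of `H^{1/2,2}(ℝ)`. -/
def innerHalf (u v : ℝ → ℝ) : ℝ :=
  (∫ x, quarterLaplacian u x * quarterLaplacian v x) + ∫ x, u x * v x

/-- The norm `‖u‖_{1/2}` of `H^{1/2,2}(ℝ)`. -/
def normHalf (u : ℝ → ℝ) : ℝ := Real.sqrt (innerHalf u u)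

/-- The primitive `F(t) = ∫₀ᵗ f(s) ds`. -/
def primitive (f : ℝ → ℝ) (t : ℝ) : ℝ := ∫ s in (0 : ℝ)..t, f s

/-- The energy functional
`I(u,v) = ∫ ((-Δ)^{1/4}u (-Δ)^{1/4}v + u v) dx - ∫ P F(u) dx - ∫ Q G(v) dx`. -/
def energy (P Q f g : ℝ → ℝ) (z : (ℝ → ℝ) × (ℝ → ℝ)) : ℝ :=
  innerHalf z.1 z.2 - (∫ x, P x * primitive f (z.1 x)) - ∫ x, Q x * primitive g (z.2 x)

/-- The truncated logarithm `ω̄_k`. -/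
def truncLog (k : ℕ) (x : ℝ) : ℝ :=
  (1 / Real.sqrt Real.pi) *
    (if |x| ≤ 1 / (k : ℝ) then Real.sqrt (Real.log k)
     else if |x| ≤ 1 then Real.log (1 / |x|) / Real.sqrt (Real.log k)
     else 0)

/-- The Moser function `m_k = ω̄_k / ‖ω̄_k‖_{1/2}`. -/
def moser (k : ℕ) (x : ℝ) : ℝ := truncLog k x / normHalf (truncLog k)

/-- The set `ℝ⁺(e,e) ⊕ ℍ⁻ = {t (e,e) + (u,-u) : t ≥ 0, u ∈ H^{1/2,2}(ℝ)}`. -/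
def halfSpace (e : ℝ → ℝ) : Set ((ℝ → ℝ) × (ℝ → ℝ)) :=
  {z | ∃ t : ℝ, 0 ≤ t ∧ ∃ u ∈ HHalf, z = t • (e, e) + (u, -u)}

/-- `h` has `α₀`-critical growth of Trudinger–Moser type at `+∞`. -/
def HasCriticalGrowth (α₀ : ℝ) (h : ℝ → ℝ) : Prop :=
  (∀ α : ℝ, α₀ < α → Tendsto (fun s => h s / (Real.exp (α * s ^ 2) - 1)) atTop (𝓝 0)) ∧
  (∀ α : ℝ, 0 < α → α < α₀ →
    Tendsto (fun s => h s / (Real.exp (α * s ^ 2) - 1)) atTop atTop)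

/-- A weight in `C₀(ℝ, ℝ⁺)`: continuous, nonnegative, vanishing at infinity. -/
structure IsWeight (P : ℝ → ℝ) : Prop where
  continuous : Continuous P
  nonneg : ∀ x, 0 ≤ P x
  vanishing : Tendsto P (cocompact ℝ) (𝓝 0)

/-- The standing assumptions on one nonlinearity `f : ℝ → [0, ∞)`, with Ambrosetti–Rabinowitz
exponent `θ` and critical exponent `α₀`. -/
structure IsNonlinearity (α₀ θ : ℝ) (f : ℝ → ℝ) : Prop where
  critical : HasCriticalGrowth α₀ f
  continuous : Continuous f
  nonneg : ∀ t, 0 ≤ f t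
  /-- `f` is extended by `0` to the negative half-line; in particular `f 0 = 0`. -/
  zero_of_nonpos : ∀ t, t ≤ 0 → f t = 0
  near_zero : f =o[𝓝 0] (fun t : ℝ => t)
  ambrosetti_rabinowitz :
    ∀ t, 0 < t → 0 < θ * primitive f t ∧ θ * primitive f t ≤ t * f t
  asymptotic : Tendsto (fun t => t * f t * Real.exp (-α₀ * t ^ 2)) atTop atTop

end FracHamiltonian

end

noncomputable section

namespace FracHamiltonian

/-! Write `m` for the Moser function, `L = log l`, `A = π / α₀`. Since `m` has norm one, the
quadratic part of the energy at `(t m + u, t m - u)` is `t² - ‖u‖²`, so `u` can only help through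
the nonlinear terms. On `|x| ≤ 1 / l` one of `t m + u`, `t m - u` is at least `t m`. Since `P` and
`Q` stay above some `c > 0` there and the primitives are monotone and nonnegative, the nonlinear
terms cost at least `(2 c / l) B`, where `B` bounds both primitives from below at `t` times the
plateau height (`energy_le`). This eliminates `u`.

The plateau height is governed by `‖ω̄_l‖² ≤ 1 + 75 / L` (`innerHalf_truncLog_le`). The leading
constant 1 has to be sharp; it comes from the explicit Fourier transform of the truncated logarithm,
a sine integral bounded by `π / 2` plus a decaying error. Hypothesis (H4) makes the primitives
exceed `K e^{α₀ s²} / s²` for any prescribed `K` (`exists_le_primitive`). With `τ = α₀ t² / π` the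
energy is then at most `A τ - (D / L) e^{(τ - 1)(L - 75)} / τ`, where `D` is proportional to `K`.
Once `D ≥ 4 A`, this stays below `A` by a margin independent of `t` and `u` (`mul_sub_exp_div_le`);
small `τ` is trivial.

The nonlinear integrals must also converge for every `u` in the space. This follows from
`integrable_sq_mul_exp`: cutting frequencies at a level `A` leaves a bounded part that grows like a
small multiple of `√(log A)` and an `L²` remainder of squared norm `O(1 / A)`, so Chebyshev gives
Gaussian tails of every rate. -/

/-! ### The `L²` Fourier transform on `L¹ ∩ L²` -/

open FourierTransform in
theorem integral_fourier_smul_eq_of_integrable {f g : ℝ → ℂ} (hf : Integrable f)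
    (hg : Integrable g) : ∫ ξ, 𝓕 f ξ • g ξ = ∫ x, f x • 𝓕 g x := by
  have h := VectorFourier.integral_fourierIntegral_smul_eq_flip (μ := volume) (ν := volume)
    (L := innerₗ ℝ) Real.continuous_fourierChar (by fun_prop) hf hg
  rw [flip_innerₗ] at h
  exact h

open FourierTransform SchwartzMap in
/-- For `f ∈ L¹ ∩ L²` the `L²` Fourier transform is given by the Fourier integral. -/
theorem fourier_toLp_ae_eq {f : ℝ → ℂ} (h1 : Integrable f) (h2 : MemLp f 2) :
    (Lp.fourierTransformₗᵢ ℝ ℂ h2.toLp : Lp ℂ 2 (volume : Measure ℝ)) =ᵐ[volume] 𝓕 f := by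
  have hcont : Continuous (𝓕 f) :=
    VectorFourier.fourierIntegral_continuous Real.continuous_fourierChar (by fun_prop) h1
  refine ae_eq_of_integral_contDiff_smul_eq ((Lp.memLp _).locallyIntegrable (by norm_num))
    hcont.locallyIntegrable fun g g_smooth g_cpt => ?_
  have hg₁ : HasCompactSupport (Complex.ofRealCLM ∘ g) := g_cpt.comp_left rfl
  have hg₂ : ContDiff ℝ (⊤ : ℕ∞) (Complex.ofRealCLM ∘ g) := by fun_prop
  set φ : 𝓢(ℝ, ℂ) := hg₁.toSchwartzMap hg₂ with hφ
  have hφx (x : ℝ) : φ x = (g x : ℂ) := rfl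
  have key := congrArg (fun T => T φ) (Lp.fourier_toTemperedDistribution_eq h2.toLp)
  simp only [TemperedDistribution.fourier_apply, Lp.toTemperedDistribution_apply] at key
  calc ∫ x, g x • (Lp.fourierTransformₗᵢ ℝ ℂ h2.toLp : Lp ℂ 2 (volume : Measure ℝ)) x
      = ∫ x, (𝓕 φ) x • (h2.toLp : Lp ℂ 2 (volume : Measure ℝ)) x := by
        rw [key]; simp only [hφx]; rfl
    _ = ∫ x, (𝓕 φ) x • f x := by
        refine integral_congr_ae ?_
        filter_upwards [h2.coeFn_toLp] with x hx
        rw [hx]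
    _ = ∫ x, φ x • 𝓕 f x :=
        integral_fourier_smul_eq_of_integrable φ.integrable h1
    _ = ∫ x, g x • 𝓕 f x := rfl

open FourierTransform SchwartzMap in
/-- For `f ∈ L¹ ∩ L²` the inverse `L²` Fourier transform is given by the inverse Fourier
integral. -/
theorem fourierInv_toLp_ae_eq {f : ℝ → ℂ} (h1 : Integrable f) (h2 : MemLp f 2) :
    ((Lp.fourierTransformₗᵢ ℝ ℂ).symm h2.toLp : Lp ℂ 2 (volume : Measure ℝ))
      =ᵐ[volume] 𝓕⁻ f := by
  have hcont : Continuous (𝓕⁻ f) := by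
    rw [Real.fourierInv_eq_fourier_comp_neg]
    exact VectorFourier.fourierIntegral_continuous Real.continuous_fourierChar (by fun_prop)
      h1.comp_neg
  refine ae_eq_of_integral_contDiff_smul_eq ((Lp.memLp _).locallyIntegrable (by norm_num))
    hcont.locallyIntegrable fun g g_smooth g_cpt => ?_
  have hg₁ : HasCompactSupport (Complex.ofRealCLM ∘ g) := g_cpt.comp_left rfl
  have hg₂ : ContDiff ℝ (⊤ : ℕ∞) (Complex.ofRealCLM ∘ g) := by fun_prop
  set φ : 𝓢(ℝ, ℂ) := hg₁.toSchwartzMap hg₂ with hφ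
  have hφx (x : ℝ) : φ x = (g x : ℂ) := rfl
  have key := congrArg (fun T => T φ) (Lp.fourierInv_toTemperedDistribution_eq h2.toLp)
  simp only [TemperedDistribution.fourierInv_apply, Lp.toTemperedDistribution_apply] at key
  calc ∫ x, g x • ((Lp.fourierTransformₗᵢ ℝ ℂ).symm h2.toLp : Lp ℂ 2 (volume : Measure ℝ)) x
      = ∫ x, (𝓕⁻ φ) x • (h2.toLp : Lp ℂ 2 (volume : Measure ℝ)) x := by
        rw [key]; simp only [hφx]; rfl
    _ = ∫ x, (𝓕⁻ φ) x • f x := by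
        refine integral_congr_ae ?_
        filter_upwards [h2.coeFn_toLp] with x hx
        rw [hx]
    _ = ∫ x, (𝓕 φ) (-x) • f x := by
        simp only [SchwartzMap.fourierInv_coe, Real.fourierInv_eq_fourier_neg,
          SchwartzMap.fourier_coe]
    _ = ∫ x, (𝓕 φ) x • f (-x) := by
        rw [← integral_neg_eq_self]; simp
    _ = ∫ x, φ x • 𝓕 (fun y => f (-y)) x :=
        integral_fourier_smul_eq_of_integrable φ.integrable h1.comp_neg
    _ = ∫ x, g x • 𝓕⁻ f x := by
        rw [Real.fourierInv_eq_fourier_comp_neg]; rfl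

-- Turns an `L¹` bound on the low frequencies of a function into a pointwise bound on its
-- low-frequency part.
open FourierTransform in
theorem norm_fourierInv_toLp_le {f : ℝ → ℂ} (h1 : Integrable f) (h2 : MemLp f 2) :
    ∀ᵐ x, ‖((Lp.fourierTransformₗᵢ ℝ ℂ).symm h2.toLp : Lp ℂ 2 (volume : Measure ℝ)) x‖
      ≤ ∫ ξ, ‖f ξ‖ := by
  filter_upwards [fourierInv_toLp_ae_eq h1 h2] with x hx
  rw [hx, Real.fourierInv_eq_fourier_neg]
  exact VectorFourier.norm_fourierIntegral_le_integral_norm _ _ _ _ _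

/-! ### Linear structure of `HHalf` and its quadratic form -/

theorem fourierL2_of_memLp {u : ℝ → ℝ} (hu : MemLp (fun x => (u x : ℂ)) 2 (volume : Measure ℝ)) :
    fourierL2 u = ⇑(Lp.fourierTransformₗᵢ ℝ ℂ hu.toLp) := by
  rw [fourierL2, dif_pos hu]

theorem quarterLaplacian_of_memLp {u : ℝ → ℝ} (hu : MemLp (quarterSymbolMul u) 2 volume) :
    quarterLaplacian u = fun x =>
      (((Lp.fourierTransformₗᵢ ℝ ℂ).symm hu.toLp : Lp ℂ 2 (volume : Measure ℝ)) x).re := by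
  rw [quarterLaplacian, dif_pos hu]

theorem memLp_fourierL2 {u : ℝ → ℝ} (hu : MemLp u 2 volume) : MemLp (fourierL2 u) 2 volume := by
  have huC : MemLp (fun x => (u x : ℂ)) 2 volume := hu.ofReal
  rw [fourierL2_of_memLp huC]
  exact Lp.memLp _

theorem fourierL2_linear {u v : ℝ → ℝ} (hu : MemLp u 2 volume) (hv : MemLp v 2 volume)
    (a b : ℝ) :
    fourierL2 (a • u + b • v) =ᵐ[volume] fun ξ => a * fourierL2 u ξ + b * fourierL2 v ξ := by
  have huC : MemLp (fun x => (u x : ℂ)) 2 volume := hu.ofReal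
  have hvC : MemLp (fun x => (v x : ℂ)) 2 volume := hv.ofReal
  have hw : MemLp (fun x => ((a • u + b • v) x : ℂ)) 2 volume :=
    ((hu.const_smul a).add (hv.const_smul b)).ofReal
  rw [fourierL2_of_memLp huC, fourierL2_of_memLp hvC, fourierL2_of_memLp hw]
  have h : hw.toLp = (a : ℂ) • huC.toLp + (b : ℂ) • hvC.toLp := by
    rw [← MemLp.toLp_const_smul, ← MemLp.toLp_const_smul, ← MemLp.toLp_add]
    refine MemLp.toLp_congr _ _ (Eventually.of_forall fun x => ?_)
    simp
  rw [h, map_add, map_smul, map_smul]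
  filter_upwards [Lp.coeFn_add ((a : ℂ) • Lp.fourierTransformₗᵢ ℝ ℂ huC.toLp)
    ((b : ℂ) • Lp.fourierTransformₗᵢ ℝ ℂ hvC.toLp),
    Lp.coeFn_smul (a : ℂ) (Lp.fourierTransformₗᵢ ℝ ℂ huC.toLp),
    Lp.coeFn_smul (b : ℂ) (Lp.fourierTransformₗᵢ ℝ ℂ hvC.toLp)] with x h1 h2 h3
  rw [h1, Pi.add_apply, h2, h3]
  simp

theorem quarterSymbolMul_linear {u v : ℝ → ℝ} (hu : MemLp u 2 volume) (hv : MemLp v 2 volume)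
    (a b : ℝ) :
    quarterSymbolMul (a • u + b • v) =ᵐ[volume]
      fun ξ => a * quarterSymbolMul u ξ + b * quarterSymbolMul v ξ := by
  filter_upwards [fourierL2_linear hu hv a b] with ξ h
  simp only [quarterSymbolMul, h]
  ring

theorem HHalf.linear {u v : ℝ → ℝ} (hu : u ∈ HHalf) (hv : v ∈ HHalf) (a b : ℝ) :
    a • u + b • v ∈ HHalf :=
  ⟨(hu.1.const_smul a).add (hv.1.const_smul b),
    ((hu.2.const_mul (a : ℂ)).add (hv.2.const_mul (b : ℂ))).ae_eq
      (quarterSymbolMul_linear hu.1 hv.1 a b).symm⟩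

theorem HHalf.smul {u : ℝ → ℝ} (hu : u ∈ HHalf) (a : ℝ) : a • u ∈ HHalf := by
  simpa using HHalf.linear hu hu a 0

theorem quarterLaplacian_linear {u v : ℝ → ℝ} (hu : u ∈ HHalf) (hv : v ∈ HHalf) (a b : ℝ) :
    quarterLaplacian (a • u + b • v) =ᵐ[volume]
      fun x => a * quarterLaplacian u x + b * quarterLaplacian v x := by
  have hw := HHalf.linear hu hv a b
  rw [quarterLaplacian_of_memLp hu.2, quarterLaplacian_of_memLp hv.2,
    quarterLaplacian_of_memLp hw.2]
  have h : hw.2.toLp = (a : ℂ) • hu.2.toLp + (b : ℂ) • hv.2.toLp := by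
    rw [← MemLp.toLp_const_smul, ← MemLp.toLp_const_smul, ← MemLp.toLp_add]
    refine MemLp.toLp_congr _ _ ?_
    filter_upwards [quarterSymbolMul_linear hu.1 hv.1 a b] with x hx
    rw [hx]
    simp
  rw [h, map_add, map_smul, map_smul]
  filter_upwards [Lp.coeFn_add ((a : ℂ) • (Lp.fourierTransformₗᵢ ℝ ℂ).symm hu.2.toLp)
    ((b : ℂ) • (Lp.fourierTransformₗᵢ ℝ ℂ).symm hv.2.toLp),
    Lp.coeFn_smul (a : ℂ) ((Lp.fourierTransformₗᵢ ℝ ℂ).symm hu.2.toLp),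
    Lp.coeFn_smul (b : ℂ) ((Lp.fourierTransformₗᵢ ℝ ℂ).symm hv.2.toLp)] with x h1 h2 h3
  rw [h1, Pi.add_apply, h2, h3]
  simp

theorem memLp_quarterLaplacian {u : ℝ → ℝ} (hu : u ∈ HHalf) :
    MemLp (quarterLaplacian u) 2 volume := by
  rw [quarterLaplacian_of_memLp hu.2]
  exact MemLp.re (Lp.memLp ((Lp.fourierTransformₗᵢ ℝ ℂ).symm hu.2.toLp))

/-- Polarisation on the orthogonal splitting `(t e + u, t e - u)`. -/
theorem innerHalf_add_sub {e u : ℝ → ℝ} (he : e ∈ HHalf) (hu : u ∈ HHalf) (t : ℝ) :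
    innerHalf (t • e + u) (t • e - u) = t ^ 2 * innerHalf e e - innerHalf u u := by
  have h1 : t • e + u = t • e + (1 : ℝ) • u := by simp
  have h2 : t • e - u = t • e + (-1 : ℝ) • u := by simp [sub_eq_add_neg]
  have key {a b : ℝ → ℝ} (ha : MemLp a 2 volume) (hb : MemLp b 2 volume) :
      ∫ x, (t * a x + 1 * b x) * (t * a x + (-1) * b x) =
        t ^ 2 * (∫ x, a x * a x) - ∫ x, b x * b x := by
    have ia : Integrable fun x => a x * a x := ha.integrable_mul ha
    have ib : Integrable fun x => b x * b x := hb.integrable_mul hb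
    rw [← integral_const_mul, ← integral_sub (ia.const_mul _) ib]
    congr 1 with x
    ring
  have hL : ∫ x, quarterLaplacian (t • e + u) x * quarterLaplacian (t • e - u) x =
      t ^ 2 * (∫ x, quarterLaplacian e x * quarterLaplacian e x)
        - ∫ x, quarterLaplacian u x * quarterLaplacian u x := by
    rw [← key (memLp_quarterLaplacian he) (memLp_quarterLaplacian hu)]
    refine integral_congr_ae ?_
    rw [h1, h2]
    filter_upwards [quarterLaplacian_linear he hu t 1, quarterLaplacian_linear he hu t (-1)]
      with x hx hy
    rw [hx, hy]
  have hI : ∫ x, (t • e + u) x * (t • e - u) x =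
      t ^ 2 * (∫ x, e x * e x) - ∫ x, u x * u x := by
    rw [← key he.1 hu.1]
    congr 1 with x
    simp only [Pi.add_apply, Pi.sub_apply, Pi.smul_apply, smul_eq_mul]
    ring
  rw [innerHalf, hL, hI, innerHalf, innerHalf]
  ring

theorem innerHalf_self_nonneg (u : ℝ → ℝ) : 0 ≤ innerHalf u u :=
  add_nonneg (integral_nonneg fun _ => mul_self_nonneg _) (integral_nonneg fun _ => mul_self_nonneg _)

theorem innerHalf_smul_self {u : ℝ → ℝ} (hu : u ∈ HHalf) (a : ℝ) :
    innerHalf (a • u) (a • u) = a ^ 2 * innerHalf u u := by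
  have h0 : (0 : ℝ → ℝ) ∈ HHalf := by simpa using HHalf.smul hu 0
  have hz : innerHalf (0 : ℝ → ℝ) 0 = 0 := by
    have := innerHalf_add_sub h0 h0 0
    simp only [smul_zero, add_zero, sub_zero] at this
    linarith
  have := innerHalf_add_sub hu h0 a
  rwa [add_zero, sub_zero, hz, sub_zero] at this

/-! ### Plancherel -/

theorem integral_norm_sq_Lp (f : Lp ℂ 2 (volume : Measure ℝ)) : ∫ x, ‖f x‖ ^ 2 = ‖f‖ ^ 2 := by
  have h : inner ℂ f f = ∫ x, inner ℂ (f x) (f x) := L2.inner_def f f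
  rw [inner_self_eq_norm_sq_to_K] at h
  simp only [inner_self_eq_norm_sq_to_K] at h
  have h' : ((∫ x, ‖f x‖ ^ 2 : ℝ) : ℂ) = ((‖f‖ ^ 2 : ℝ) : ℂ) := by
    have h3 := integral_ofReal (μ := volume) (𝕜 := ℂ) (f := fun x => ‖f x‖ ^ 2)
    push_cast at h3 ⊢
    exact h3.symm.trans h.symm
  exact_mod_cast h'

theorem integral_norm_sq_toLp {f : ℝ → ℂ} (hf : MemLp f 2 volume) :
    ‖hf.toLp‖ ^ 2 = ∫ x, ‖f x‖ ^ 2 := by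
  rw [← integral_norm_sq_Lp]
  refine integral_congr_ae ?_
  filter_upwards [hf.coeFn_toLp] with x hx
  rw [hx]

/-- Plancherel, with an inequality because `quarterLaplacian` keeps only the real part. Norms are
only needed from above here, so the inverse transform need not be shown to be real. -/
theorem integral_quarterLaplacian_sq_le {u : ℝ → ℝ} (hu : MemLp (quarterSymbolMul u) 2 volume) :
    ∫ x, quarterLaplacian u x * quarterLaplacian u x ≤ ∫ ξ, ‖quarterSymbolMul u ξ‖ ^ 2 := by
  rw [← integral_norm_sq_toLp hu, ← (Lp.fourierTransformₗᵢ ℝ ℂ).symm.norm_map hu.toLp,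
    ← integral_norm_sq_Lp, quarterLaplacian_of_memLp hu]
  refine integral_mono_of_nonneg (Eventually.of_forall fun _ => mul_self_nonneg _)
    ((memLp_two_iff_integrable_sq_norm (Lp.memLp _).1).1 (Lp.memLp _))
    (Eventually.of_forall fun x => ?_)
  simp only [← Complex.normSq_eq_norm_sq, Complex.normSq_apply]
  nlinarith [mul_self_nonneg ((((Lp.fourierTransformₗᵢ ℝ ℂ).symm hu.toLp :
    Lp ℂ 2 (volume : Measure ℝ)) x).im)]

/-! ### Gaussian tails and exponential integrability in `HHalf` -/

theorem integrable_comp_abs {f : ℝ → ℝ} (hf : IntegrableOn f (Set.Ioi 0)) :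
    Integrable fun x => f |x| := by
  have h1 : IntegrableOn (fun x => f |x|) (Set.Ioi 0) :=
    hf.congr_fun (fun x hx => by rw [abs_of_pos hx]) measurableSet_Ioi
  have h2 : IntegrableOn (fun x => f |x|) (Set.Iic 0) := by
    rw [← Measure.map_neg_eq_self (volume : Measure ℝ)]
    let m : MeasurableEmbedding fun x : ℝ => -x := (Homeomorph.neg ℝ).measurableEmbedding
    rw [m.integrableOn_map_iff]
    simp_rw [Function.comp_def, abs_neg, Set.neg_preimage, Set.neg_Iic, neg_zero]
    exact Iff.mpr integrableOn_Ici_iff_integrableOn_Ioi h1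
  have := h2.union h1
  rwa [Set.Iic_union_Ioi, integrableOn_univ] at this

theorem norm_quarterSymbolMul_sq (u : ℝ → ℝ) (ξ : ℝ) :
    ‖quarterSymbolMul u ξ‖ ^ 2 = |2 * Real.pi * ξ| * ‖fourierL2 u ξ‖ ^ 2 := by
  have h := abs_nonneg (2 * Real.pi * ξ)
  rw [quarterSymbolMul, norm_mul, mul_pow, Complex.norm_real, Real.norm_eq_abs, sq_abs,
    ← Real.rpow_natCast, ← Real.rpow_mul h]
  norm_num

theorem integrable_quarterSymbolMul_sq {u : ℝ → ℝ} (hu : u ∈ HHalf) :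
    Integrable fun ξ => ‖quarterSymbolMul u ξ‖ ^ 2 :=
  (memLp_two_iff_integrable_sq_norm hu.2.1).1 hu.2

theorem integrableOn_fourierL2 {u : ℝ → ℝ} (hu : u ∈ HHalf) (A : ℝ) :
    IntegrableOn (fourierL2 u) (Set.Icc (-A) A) :=
  ((memLp_fourierL2 hu.1).restrict _).integrable (by norm_num)

/-- Splitting the frequencies at `A`: the low part is bounded, the high part is small in `L²`. -/
theorem volume_le_of_split {u : ℝ → ℝ} (hu : u ∈ HHalf) {A : ℝ} (hA : 0 < A) :
    volume {x | (∫ ξ in Set.Icc (-A) A, ‖fourierL2 u ξ‖) + 1 ≤ |u x|} ≤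
      ENNReal.ofReal ((∫ ξ, ‖quarterSymbolMul u ξ‖ ^ 2) / A) := by
  set S := Set.Icc (-A) A with hS
  have hSm : MeasurableSet S := measurableSet_Icc
  set W := fourierL2 u with hW
  have hW2 : MemLp W 2 volume := memLp_fourierL2 hu.1
  have h1 : MemLp (S.indicator W) 2 volume := hW2.indicator hSm
  have h2 : MemLp (Sᶜ.indicator W) 2 volume := hW2.indicator hSm.compl
  have h1i : Integrable (S.indicator W) :=
    (integrable_indicator_iff hSm).2 (integrableOn_fourierL2 hu A)
  have huC : MemLp (fun x => (u x : ℂ)) 2 volume := hu.1.ofReal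
  set T := Lp.fourierTransformₗᵢ ℝ ℂ
  have hT : T huC.toLp = h1.toLp + h2.toLp := by
    rw [← MemLp.toLp_add]
    refine Lp.ext ?_
    filter_upwards [(h1.add h2).coeFn_toLp] with x hx
    rw [hx, ← fourierL2_of_memLp huC, Set.indicator_self_add_compl]
  have hU : huC.toLp = T.symm h1.toLp + T.symm h2.toLp := by
    rw [← map_add, ← hT, T.symm_apply_apply]
  set H : Lp ℂ 2 (volume : Measure ℝ) := T.symm h2.toLp with hH
  have hle : ∀ᵐ x, |u x| ≤ (∫ ξ in S, ‖W ξ‖) + ‖H x‖ := by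
    have e : ∫ ξ, ‖S.indicator W ξ‖ = ∫ ξ in S, ‖W ξ‖ := by
      rw [← integral_indicator hSm]
      congr 1 with ξ
      rw [norm_indicator_eq_indicator_norm]
    filter_upwards [norm_fourierInv_toLp_le h1i h1, huC.coeFn_toLp,
      Lp.coeFn_add (T.symm h1.toLp) H] with x hx hy hz
    rw [hU, hz, Pi.add_apply] at hy
    rw [← e]
    calc |u x| = ‖(u x : ℂ)‖ := by simp
      _ ≤ _ := by
        rw [← hy]
        exact (norm_add_le _ _).trans (by gcongr)
  have hHi : Integrable fun x => ‖H x‖ ^ 2 :=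
    (memLp_two_iff_integrable_sq_norm (Lp.memLp H).1).1 (Lp.memLp H)
  -- On the high frequencies `|2πξ| ≥ A`, so the weight in `quarterSymbolMul` gains a factor `1 /
  -- A`.
  have hHle : ∫ x, ‖H x‖ ^ 2 ≤ (∫ ξ, ‖quarterSymbolMul u ξ‖ ^ 2) / A := by
    rw [integral_norm_sq_Lp, hH, T.symm.norm_map, integral_norm_sq_toLp, ← integral_div]
    refine integral_mono ((memLp_two_iff_integrable_sq_norm h2.1).1 h2)
      ((integrable_quarterSymbolMul_sq hu).div_const A) fun ξ => ?_
    simp only []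
    by_cases hξ : ξ ∈ S
    · rw [Set.indicator_of_notMem (s := Sᶜ) (fun h => h hξ), norm_zero, zero_pow two_ne_zero]
      positivity
    · rw [Set.indicator_of_mem (show ξ ∈ Sᶜ from hξ), norm_quarterSymbolMul_sq, le_div_iff₀ hA,
        mul_comm]
      gcongr
      have : A ≤ |ξ| := by
        rw [hS, Set.mem_Icc, ← abs_le] at hξ
        exact (not_le.1 hξ).le
      rw [abs_mul, abs_of_pos (by positivity)]
      nlinarith [Real.pi_gt_three]
  -- Chebyshev: where `|u|` exceeds the low-frequency bound by 1, the remainder `H` has modulus at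
  -- least 1.
  calc volume {x | (∫ ξ in S, ‖W ξ‖) + 1 ≤ |u x|}
      ≤ volume {x | 1 ≤ ENNReal.ofReal (‖H x‖ ^ 2)} := by
        refine measure_mono_ae ?_
        filter_upwards [hle] with x hx hx'
        have hx' : (∫ ξ in S, ‖W ξ‖) + 1 ≤ |u x| := hx'
        have : (1 : ℝ) ≤ ‖H x‖ := by linarith
        exact ENNReal.one_le_ofReal.2 (one_le_pow₀ this)
    _ ≤ ∫⁻ x, ENNReal.ofReal (‖H x‖ ^ 2) := by
        simpa using mul_meas_ge_le_lintegral₀ hHi.aestronglyMeasurable.aemeasurable.ennreal_ofReal 1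
    _ = ENNReal.ofReal (∫ x, ‖H x‖ ^ 2) :=
        (ofReal_integral_eq_lintegral_ofReal hHi (Eventually.of_forall fun _ => by positivity)).symm
    _ ≤ _ := ENNReal.ofReal_le_ofReal hHle

theorem exists_tail_le {φ : ℝ → ℝ} (hφ : Integrable φ) {δ : ℝ} (hδ : 0 < δ) :
    ∃ R : ℝ, 1 ≤ R ∧ ∫ ξ in (Set.Icc (-R) R)ᶜ, φ ξ ≤ δ := by
  have h := tendsto_setIntegral_of_antitone (μ := volume) (f := φ)
    (s := fun n : ℕ => (Set.Icc (-(n : ℝ)) n)ᶜ) (fun n => measurableSet_Icc.compl)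
    (fun m n hmn => Set.compl_subset_compl.2 (Set.Icc_subset_Icc (by simpa using hmn)
      (by simpa using hmn))) ⟨0, hφ.integrableOn⟩
  have he : ⋂ n : ℕ, (Set.Icc (-(n : ℝ)) n)ᶜ = ∅ := by
    refine Set.eq_empty_of_forall_notMem fun x hx => ?_
    obtain ⟨n, hn⟩ := exists_nat_ge |x|
    exact Set.mem_iInter.1 hx n (abs_le.1 hn)
  rw [he, setIntegral_empty] at h
  obtain ⟨n, hn, hn1⟩ := ((h.eventually_le_const hδ).and (eventually_ge_atTop 1)).exists
  exact ⟨n, by exact_mod_cast hn1, hn⟩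

/-- Logarithmic growth, with arbitrarily small constant, of the truncated Fourier `L¹` norm. -/
theorem exists_integral_norm_fourierL2_le {u : ℝ → ℝ} (hu : u ∈ HHalf) {δ : ℝ} (hδ : 0 < δ) :
    ∃ C : ℝ, ∀ A : ℝ, 1 ≤ A → ∀ κ : ℝ, 0 < κ →
      ∫ ξ in Set.Icc (-A) A, ‖fourierL2 u ξ‖ ≤ C + κ * δ + Real.log A / κ := by
  obtain ⟨R, hR1, hR⟩ := exists_tail_le (integrable_quarterSymbolMul_sq hu) hδ
  refine ⟨∫ ξ in Set.Icc (-R) R, ‖fourierL2 u ξ‖, fun A hA κ hκ => ?_⟩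
  set h : ℝ → ℝ := (Set.Ioc 1 A).indicator fun x => x⁻¹ with hh
  have hhi : IntegrableOn (fun x : ℝ => x⁻¹) (Set.Ioc 1 A) :=
    ((continuousOn_inv₀.mono fun x hx => by
      have := hx.1
      simp only [Set.mem_compl_iff, Set.mem_singleton_iff]
      linarith).integrableOn_Icc).mono_set Set.Ioc_subset_Icc_self
  have hsub : Set.Ioc (1 : ℝ) A ⊆ Set.Ioi 0 := fun x hx => by
    have := hx.1
    simp only [Set.mem_Ioi]
    linarith
  have hint : ∫ x, h |x| = 2 * Real.log A := by
    rw [integral_comp_abs, hh, setIntegral_indicator measurableSet_Ioc,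
      Set.inter_eq_right.2 hsub, ← intervalIntegral.integral_of_le hA,
      integral_inv_of_pos one_pos (by linarith), div_one]
  have hhi' : Integrable fun x => h |x| :=
    integrable_comp_abs ((integrable_indicator_iff measurableSet_Ioc).2 hhi).integrableOn
  have hWi : Integrable ((Set.Icc (-R) R).indicator fun ξ => ‖fourierL2 u ξ‖) :=
    (integrable_indicator_iff measurableSet_Icc).2 (integrableOn_fourierL2 hu R).norm
  have hqi : Integrable ((Set.Icc (-R) R)ᶜ.indicator fun ξ => ‖quarterSymbolMul u ξ‖ ^ 2) :=
    (integrable_quarterSymbolMul_sq hu).indicator measurableSet_Icc.compl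
  have hh0 (x : ℝ) : 0 ≤ h |x| :=
    Set.indicator_nonneg (fun y hy => inv_nonneg.2 (by linarith [hy.1])) _
  calc ∫ ξ in Set.Icc (-A) A, ‖fourierL2 u ξ‖
      = ∫ ξ, (Set.Icc (-A) A).indicator (fun ξ => ‖fourierL2 u ξ‖) ξ :=
        (integral_indicator measurableSet_Icc).symm
    -- Beyond `R` use `w ≤ κ |ξ| w² / 2 + 1 / (2 κ |ξ|)`: the first term is controlled by the small
    -- energy tail, the second integrates to a logarithm. `R ≥ 1` ensures that these `|ξ|` lie in
    -- `(1, A]`.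
    _ ≤ ∫ ξ, ((Set.Icc (-R) R).indicator (fun ξ => ‖fourierL2 u ξ‖) ξ
          + κ * (Set.Icc (-R) R)ᶜ.indicator (fun ξ => ‖quarterSymbolMul u ξ‖ ^ 2) ξ
          + (1 / (2 * κ)) * h |ξ|) := by
        refine integral_mono ((integrable_indicator_iff measurableSet_Icc).2
          (integrableOn_fourierL2 hu A).norm) ((hWi.add (hqi.const_mul κ)).add
          (hhi'.const_mul _)) fun ξ => ?_
        simp only []
        have hk := mul_nonneg (by positivity : 0 ≤ 1 / (2 * κ)) (hh0 ξ)
        by_cases hξR : ξ ∈ Set.Icc (-R) R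
        · rw [Set.indicator_of_mem hξR,
            Set.indicator_of_notMem (s := (Set.Icc (-R) R)ᶜ) (fun h => h hξR)]
          have : (Set.Icc (-A) A).indicator (fun ξ => ‖fourierL2 u ξ‖) ξ ≤ ‖fourierL2 u ξ‖ :=
            Set.indicator_le_self' (fun _ _ => norm_nonneg _) ξ
          linarith
        · rw [Set.indicator_of_notMem hξR,
            Set.indicator_of_mem (s := (Set.Icc (-R) R)ᶜ) (show ξ ∈ _ from hξR)]
          by_cases hξA : ξ ∈ Set.Icc (-A) A
          · rw [Set.indicator_of_mem hξA]
            have hR' : R < |ξ| := by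
              rw [Set.mem_Icc, ← abs_le] at hξR
              exact not_le.1 hξR
            have hA' : |ξ| ≤ A := abs_le.2 hξA
            rw [hh, Set.indicator_of_mem (s := Set.Ioc 1 A) ⟨by linarith, hA'⟩, norm_quarterSymbolMul_sq, abs_mul,
              abs_of_pos (show 0 < 2 * Real.pi by positivity)]
            have hx : 0 < |ξ| := by linarith
            set w := ‖fourierL2 u ξ‖
            have key : 0 ≤ (κ * |ξ| * w - 1) ^ 2 / (2 * κ * |ξ|) := by positivity
            have e : (κ * |ξ| * w - 1) ^ 2 / (2 * κ * |ξ|) =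
                κ * (|ξ| * w ^ 2) / 2 - w + 1 / (2 * κ) * |ξ|⁻¹ := by
              field_simp
              ring
            have hm : 0 ≤ κ * (|ξ| * w ^ 2) := by positivity
            have : 0 + κ * (2 * Real.pi * |ξ| * w ^ 2) = 2 * Real.pi * (κ * (|ξ| * w ^ 2)) := by
              ring
            rw [this]
            nlinarith [Real.pi_gt_three]
          · rw [Set.indicator_of_notMem hξA]
            positivity
    _ = (∫ ξ in Set.Icc (-R) R, ‖fourierL2 u ξ‖)
          + κ * (∫ ξ in (Set.Icc (-R) R)ᶜ, ‖quarterSymbolMul u ξ‖ ^ 2)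
          + (1 / (2 * κ)) * (2 * Real.log A) := by
        rw [integral_add (by exact hWi.add (hqi.const_mul κ)) (hhi'.const_mul _),
          integral_add hWi (hqi.const_mul κ), integral_const_mul, integral_const_mul, hint,
          integral_indicator measurableSet_Icc, integral_indicator measurableSet_Icc.compl]
    _ ≤ _ := by
        have : (1 / (2 * κ)) * (2 * Real.log A) = Real.log A / κ := by field_simp
        rw [this]
        gcongr

/-- Gaussian decay, at any rate, of the distribution function of `u ∈ H^{1/2,2}(ℝ)`. -/
theorem exists_volume_le_exp {u : ℝ → ℝ} (hu : u ∈ HHalf) {γ : ℝ} (hγ : 0 < γ) :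
    ∃ K : ℝ, 0 ≤ K ∧ ∃ n₀ : ℕ, ∀ n : ℕ, n₀ ≤ n →
      volume {x | (n : ℝ) ≤ |u x|} ≤ ENNReal.ofReal (K * Real.exp (-γ * n ^ 2)) := by
  obtain ⟨C, hC⟩ := exists_integral_norm_fourierL2_le hu (δ := 1 / (16 * γ)) (by positivity)
  refine ⟨∫ ξ, ‖quarterSymbolMul u ξ‖ ^ 2, integral_nonneg fun _ => by positivity,
    max 1 ⌈2 * (C + 1)⌉₊, fun n hn => ?_⟩
  have hn1 : (1 : ℝ) ≤ n := by exact_mod_cast (le_max_left _ _).trans hn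
  have hn2 : 2 * (C + 1) ≤ n := Nat.ceil_le.1 ((le_max_right _ _).trans hn)
  -- With `A = e^{γ n²}`, `κ = 4 γ n` and `δ = 1 / (16 γ)` both error terms equal `n / 4`, so the
  -- low-frequency bound plus 1 is `C + n / 2 + 1 ≤ n`.
  have h := hC (Real.exp (γ * n ^ 2)) (Real.one_le_exp (by positivity)) (4 * γ * n)
    (by positivity)
  rw [Real.log_exp] at h
  have e : C + 4 * γ * n * (1 / (16 * γ)) + γ * n ^ 2 / (4 * γ * n) = C + n / 2 := by
    field_simp
    ring
  rw [e] at h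
  calc volume {x | (n : ℝ) ≤ |u x|} ≤ _ := measure_mono fun x (hx : (n : ℝ) ≤ |u x|) =>
        show _ ≤ |u x| by linarith
    _ ≤ _ := volume_le_of_split hu (Real.exp_pos (γ * n ^ 2))
    _ = _ := by rw [neg_mul, Real.exp_neg, div_eq_mul_inv]

/-- A weak form of the Trudinger–Moser inequality: `u² e^{βu²}` is integrable for every
`u ∈ H^{1/2,2}(ℝ)` and every `β`. -/
theorem integrable_sq_mul_exp {u : ℝ → ℝ} (hu : u ∈ HHalf) {β : ℝ} (hβ : 0 ≤ β) :
    Integrable fun x => u x ^ 2 * Real.exp (β * u x ^ 2) := by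
  -- On `k ≤ |u| < k + 1` with `k ≥ 1` the integrand is at most `e^{(β + 1)(k + 1)²} ≤ e^{4 (β + 1)
  -- k²}`; the extra 1 in the rate leaves a summable `e^{-k²}`.
  obtain ⟨K, hK, n₀, hn₀⟩ := exists_volume_le_exp hu (γ := 4 * (β + 1) + 1) (by positivity)
  have hum : AEStronglyMeasurable u volume := hu.1.1
  have hexp : Continuous fun s : ℝ => s ^ 2 * Real.exp (β * s ^ 2) := by fun_prop
  refine ⟨hexp.comp_aestronglyMeasurable hum, ?_⟩
  set m := max n₀ 1 with hm
  set c : ℕ → ℝ := fun n => Real.exp ((β + 1) * (n + 1) ^ 2) with hc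
  set E : ℕ → Set ℝ := fun n => {x | ((n + m : ℕ) : ℝ) ≤ |u x|} with hE
  have hEm (n : ℕ) : NullMeasurableSet (E n) volume :=
    nullMeasurableSet_le aemeasurable_const (continuous_abs.measurable.comp_aemeasurable hum.aemeasurable)
  have hpt (x : ℝ) : ENNReal.ofReal (u x ^ 2 * Real.exp (β * u x ^ 2)) ≤
      ENNReal.ofReal (Real.exp (β * m ^ 2) * u x ^ 2) +
        ∑' n, (E n).indicator (fun _ => ENNReal.ofReal (c (n + m))) x := by
    rw [← sq_abs (u x)]
    rcases lt_or_ge |u x| m with h | h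
    · refine le_trans (ENNReal.ofReal_le_ofReal ?_) le_self_add
      rw [mul_comm]
      gcongr
    · refine le_trans ?_ le_add_self
      obtain ⟨n, hn⟩ := Nat.exists_eq_add_of_le' (Nat.le_floor h)
      refine le_trans ?_ (ENNReal.le_tsum n)
      have h1 : ((n + m : ℕ) : ℝ) ≤ |u x| := by
        rw [← hn]
        exact Nat.floor_le (abs_nonneg _)
      have h2 : |u x| < ((n + m : ℕ) : ℝ) + 1 := by
        rw [← hn]
        exact Nat.lt_floor_add_one _
      rw [Set.indicator_of_mem (show x ∈ E n from h1)]
      refine ENNReal.ofReal_le_ofReal ?_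
      calc |u x| ^ 2 * Real.exp (β * |u x| ^ 2)
          ≤ Real.exp (|u x| ^ 2) * Real.exp (β * |u x| ^ 2) := by
            gcongr
            linarith [Real.add_one_le_exp (|u x| ^ 2)]
        _ = Real.exp ((β + 1) * |u x| ^ 2) := by
            rw [← Real.exp_add]
            ring_nf
        _ ≤ c (n + m) := by
            simp only [hc]
            gcongr
  have hterm (n : ℕ) : ENNReal.ofReal (c (n + m)) * volume (E n) ≤
      ENNReal.ofReal (K * Real.exp (-(n : ℝ))) := by
    calc _ ≤ ENNReal.ofReal (c (n + m)) *
          ENNReal.ofReal (K * Real.exp (-(4 * (β + 1) + 1) * ((n + m : ℕ) : ℝ) ^ 2)) := by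
          gcongr
          exact hn₀ (n + m) (by omega)
      _ ≤ _ := by
          rw [← ENNReal.ofReal_mul (Real.exp_pos _).le]
          refine ENNReal.ofReal_le_ofReal ?_
          rw [mul_left_comm, ← Real.exp_add]
          gcongr
          have hk : (1 : ℝ) ≤ ((n + m : ℕ) : ℝ) := by
            exact_mod_cast (by omega : 1 ≤ n + m)
          have hnk : (n : ℝ) ≤ ((n + m : ℕ) : ℝ) := by
            exact_mod_cast (by omega : n ≤ n + m)
          set k := ((n + m : ℕ) : ℝ)
          have h4 : (k + 1) ^ 2 ≤ 4 * k ^ 2 := by nlinarith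
          nlinarith [mul_le_mul_of_nonneg_left h4 (by positivity : 0 ≤ β + 1)]
  have hsum : Summable fun n : ℕ => K * Real.exp (-(n : ℝ)) :=
    Real.summable_exp_neg_nat.mul_left K
  rw [hasFiniteIntegral_iff_ofReal (Eventually.of_forall fun x => by positivity)]
  calc _ ≤ ∫⁻ x, (ENNReal.ofReal (Real.exp (β * m ^ 2) * u x ^ 2) +
        ∑' n, (E n).indicator (fun _ => ENNReal.ofReal (c (n + m))) x) := lintegral_mono hpt
    _ = (∫⁻ x, ENNReal.ofReal (Real.exp (β * m ^ 2) * u x ^ 2)) +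
        ∑' n, ENNReal.ofReal (c (n + m)) * volume (E n) := by
        rw [lintegral_add_left' ((hum.aemeasurable.pow_const 2).const_mul _).ennreal_ofReal,
          lintegral_tsum fun n => (aemeasurable_const.indicator₀ (hEm n))]
        congr 2 with n
        rw [lintegral_indicator_const₀ (hEm n)]
    _ < ⊤ := by
        refine ENNReal.add_lt_top.2 ⟨?_, ?_⟩
        · have hi : Integrable fun x => Real.exp (β * m ^ 2) * u x ^ 2 :=
            hu.1.integrable_sq.const_mul _
          exact (hasFiniteIntegral_iff_ofReal
            (Eventually.of_forall fun x => by positivity)).1 hi.2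
        · exact (ENNReal.tsum_le_tsum hterm).trans_lt hsum.tsum_ofReal_lt_top

/-! ### Bounds for the sine integral -/

/-- The Laplace transform of `sin` over `[a, b]` in closed form. -/
theorem integral_sin_mul_exp_neg (a b y : ℝ) :
    ∫ s in a..b, Real.sin s * Real.exp (-s * y) =
      Real.exp (-a * y) * (Real.cos a + y * Real.sin a) / (1 + y ^ 2)
        - Real.exp (-b * y) * (Real.cos b + y * Real.sin b) / (1 + y ^ 2) := by
  have hy : (1 + y ^ 2) ≠ 0 := by positivity
  have h (s : ℝ) : HasDerivAt
      (fun s => -(Real.exp (-s * y) * (Real.cos s + y * Real.sin s) / (1 + y ^ 2)))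
      (Real.sin s * Real.exp (-s * y)) s := by
    have h1 : HasDerivAt (fun s : ℝ => Real.exp (-s * y)) (Real.exp (-s * y) * (-1 * y)) s :=
      ((hasDerivAt_neg s).mul_const y).exp
    have h2 : HasDerivAt (fun s => Real.cos s + y * Real.sin s)
        (-Real.sin s + y * Real.cos s) s :=
      (Real.hasDerivAt_cos s).add ((Real.hasDerivAt_sin s).const_mul y)
    refine ((h1.mul h2).div_const (1 + y ^ 2)).neg.congr_deriv ?_
    rw [← neg_div, div_eq_iff hy]
    ring
  rw [intervalIntegral.integral_eq_sub_of_hasDerivAt (fun s _ => h s)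
    (by exact Continuous.intervalIntegrable (by fun_prop) _ _)]
  ring

/-- Fubini after writing `1 / s` as the integral of `e^{-s y}` over `y > 0`; the majorant `e^{-a y}`
makes it legitimate. -/
theorem integral_sin_div_eq {a b : ℝ} (ha : 0 < a) (hab : a ≤ b) :
    ∫ s in a..b, Real.sin s / s =
      ∫ y in Set.Ioi (0 : ℝ), ∫ s in a..b, Real.sin s * Real.exp (-s * y) := by
  have hpos {s : ℝ} (hs : s ∈ Set.Ioc a b) : 0 < s := ha.trans hs.1
  simp_rw [intervalIntegral.integral_of_le hab]
  rw [← integral_integral_swap]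
  · refine setIntegral_congr_fun measurableSet_Ioc fun s hs => ?_
    have h0 := hpos hs
    rw [integral_const_mul, integral_exp_mul_Ioi (neg_lt_zero.2 h0)]
    simp only [mul_zero, Real.exp_zero]
    field_simp
  · have h1 : Integrable (fun _ : ℝ => (1 : ℝ)) (volume.restrict (Set.Ioc a b)) :=
      integrable_const _
    have h2 : Integrable (fun y : ℝ => Real.exp (-a * y)) (volume.restrict (Set.Ioi 0)) :=
      integrableOn_exp_mul_Ioi (neg_lt_zero.2 ha) 0
    refine (h1.mul_prod h2).mono' (Continuous.aestronglyMeasurable (by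
      simp only [Function.uncurry_def]; fun_prop)) ?_
    rw [Measure.prod_restrict]
    refine (ae_restrict_iff' (measurableSet_Ioc.prod measurableSet_Ioi)).2
      (Eventually.of_forall fun z hz => ?_)
    have hz1 := hz.1.1
    have hz2 : 0 < z.2 := hz.2
    simp only [Function.uncurry_def, norm_mul, Real.norm_eq_abs, Real.abs_exp]
    refine mul_le_mul (Real.abs_sin_le_one _) ?_ (Real.exp_pos _).le zero_le_one
    refine Real.exp_le_exp.2 ?_
    nlinarith

theorem abs_cos_add_mul_sin_le_exp {a y : ℝ} (ha : 0 ≤ a) (hy : 0 ≤ y) :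
    Real.exp (-a * y) * |Real.cos a + y * Real.sin a| ≤ 1 := by
  have h1 : |Real.cos a + y * Real.sin a| ≤ 1 + y * a := by
    refine (abs_add_le _ _).trans (add_le_add (Real.abs_cos_le_one a) ?_)
    rw [abs_mul, abs_of_nonneg hy]
    gcongr
    exact (Real.abs_sin_le_abs).trans_eq (abs_of_nonneg ha)
  have h2 : 1 + y * a ≤ Real.exp (a * y) := by linarith [Real.add_one_le_exp (a * y)]
  calc _ ≤ Real.exp (-a * y) * Real.exp (a * y) := by gcongr; exact h1.trans h2
    _ = 1 := by rw [← Real.exp_add]; simp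

theorem abs_cos_add_mul_sin_le (b y : ℝ) : |Real.cos b + y * Real.sin b| ≤ 1 + y ^ 2 := by
  refine abs_le_of_sq_le_sq ?_ (by positivity)
  have h1 : (Real.cos b + y * Real.sin b) ^ 2 ≤ 1 + y ^ 2 := by
    nlinarith [Real.sin_sq_add_cos_sq b, sq_nonneg (y * Real.cos b - Real.sin b)]
  nlinarith [sq_nonneg y]

theorem abs_exp_mul_cos_add_mul_sin_div_le (b y : ℝ) :
    |Real.exp (-b * y) * (Real.cos b + y * Real.sin b) / (1 + y ^ 2)| ≤ Real.exp (-b * y) := by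
  rw [abs_div, abs_mul, Real.abs_exp, abs_of_pos (by positivity : 0 < 1 + y ^ 2),
    div_le_iff₀ (by positivity)]
  gcongr
  exact abs_cos_add_mul_sin_le b y

theorem integral_Ioi_exp_neg_mul {b : ℝ} (hb : 0 < b) :
    ∫ y in Set.Ioi (0 : ℝ), Real.exp (-b * y) = 1 / b := by
  rw [integral_exp_mul_Ioi (neg_lt_zero.2 hb)]
  simp [neg_div_neg_eq]

/-- The endpoint `a` contributes at most `1 / (1 + y²)` under the Laplace integral, the endpoint `b`
at most `e^{-b y}`. The constant `π / 2` is what makes the norm of `truncLog` tend to 1. -/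
theorem abs_integral_sin_div_le_pi {a b : ℝ} (ha : 0 < a) (hab : a ≤ b) :
    |∫ s in a..b, Real.sin s / s| ≤ Real.pi / 2 + 1 / b := by
  have hb : 0 < b := ha.trans_le hab
  rw [integral_sin_div_eq ha hab]
  have h1 : IntegrableOn (fun y : ℝ => (1 + y ^ 2)⁻¹) (Set.Ioi 0) :=
    integrable_inv_one_add_sq.integrableOn
  have h2 : IntegrableOn (fun y : ℝ => Real.exp (-b * y)) (Set.Ioi 0) :=
    integrableOn_exp_mul_Ioi (neg_lt_zero.2 hb) 0
  have h : ∫ y in Set.Ioi (0 : ℝ), ((1 + y ^ 2)⁻¹ + Real.exp (-b * y)) = Real.pi / 2 + 1 / b := by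
    rw [integral_add h1 h2, integral_Ioi_inv_one_add_sq, Real.arctan_zero, sub_zero,
      integral_Ioi_exp_neg_mul hb]
  rw [← h, ← Real.norm_eq_abs]
  refine norm_integral_le_of_norm_le (h1.add h2)
    ((ae_restrict_iff' measurableSet_Ioi).2 (Eventually.of_forall fun y hy => ?_))
  rw [integral_sin_mul_exp_neg, Real.norm_eq_abs]
  refine (abs_sub _ _).trans (add_le_add ?_ (abs_exp_mul_cos_add_mul_sin_div_le b y))
  rw [abs_div, abs_mul, Real.abs_exp, abs_of_pos (by positivity : 0 < 1 + y ^ 2), ← one_div]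
  gcongr
  exact abs_cos_add_mul_sin_le_exp ha.le (le_of_lt hy)

/-- Bounding both endpoint terms by exponentials gives decay in `a`, needed for frequencies beyond
`l`. -/
theorem abs_integral_sin_div_le_inv {a b : ℝ} (ha : 0 < a) (hab : a ≤ b) :
    |∫ s in a..b, Real.sin s / s| ≤ 1 / a + 1 / b := by
  have hb : 0 < b := ha.trans_le hab
  rw [integral_sin_div_eq ha hab]
  have h1 : IntegrableOn (fun y : ℝ => Real.exp (-a * y)) (Set.Ioi 0) :=
    integrableOn_exp_mul_Ioi (neg_lt_zero.2 ha) 0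
  have h2 : IntegrableOn (fun y : ℝ => Real.exp (-b * y)) (Set.Ioi 0) :=
    integrableOn_exp_mul_Ioi (neg_lt_zero.2 hb) 0
  have h : ∫ y in Set.Ioi (0 : ℝ), (Real.exp (-a * y) + Real.exp (-b * y)) = 1 / a + 1 / b := by
    rw [integral_add h1 h2, integral_Ioi_exp_neg_mul ha, integral_Ioi_exp_neg_mul hb]
  rw [← h, ← Real.norm_eq_abs]
  refine norm_integral_le_of_norm_le (h1.add h2) (Eventually.of_forall fun y => ?_)
  rw [integral_sin_mul_exp_neg, Real.norm_eq_abs]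
  exact (abs_sub _ _).trans (add_le_add (abs_exp_mul_cos_add_mul_sin_div_le a y)
    (abs_exp_mul_cos_add_mul_sin_div_le b y))

theorem abs_integral_sin_div_le_self {a b : ℝ} (ha : 0 < a) (hab : a ≤ b) :
    |∫ s in a..b, Real.sin s / s| ≤ b := by
  have h := intervalIntegral.norm_integral_le_of_norm_le_const (a := a) (b := b) (C := 1)
    (f := fun s => Real.sin s / s) fun s hs => by
      rw [Set.uIoc_of_le hab] at hs
      have : 0 < s := ha.trans hs.1
      rw [norm_div, Real.norm_eq_abs, Real.norm_eq_abs, div_le_one (abs_pos.2 this.ne')]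
      exact Real.abs_sin_le_abs
  rw [Real.norm_eq_abs, one_mul, abs_of_nonneg (sub_nonneg.2 hab)] at h
  linarith

/-! ### The truncated logarithm and its Fourier transform -/

theorem measurable_truncLog (l : ℕ) : Measurable (truncLog l) := by
  unfold truncLog
  refine Measurable.const_mul (Measurable.ite (measurableSet_le (by fun_prop) (by fun_prop))
    (by fun_prop) (Measurable.ite (measurableSet_le (by fun_prop) (by fun_prop)) ?_
      (by fun_prop))) _
  exact (Real.measurable_log.comp (by fun_prop)).div_const _

theorem truncLog_abs (l : ℕ) (x : ℝ) : truncLog l |x| = truncLog l x := by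
  simp only [truncLog, abs_abs]

theorem truncLog_of_le {l : ℕ} {x : ℝ} (hx : |x| ≤ 1 / l) :
    truncLog l x = Real.sqrt (Real.log l) / Real.sqrt Real.pi := by
  rw [truncLog, if_pos hx]
  ring

theorem truncLog_of_mem_Ioc {l : ℕ} {x : ℝ} (hx : x ∈ Set.Ioc (1 / (l : ℝ)) 1) :
    truncLog l x = -Real.log x / (Real.sqrt Real.pi * Real.sqrt (Real.log l)) := by
  have h0 : 0 < x := lt_of_le_of_lt (by positivity) hx.1
  rw [truncLog, abs_of_pos h0, if_neg (not_le.2 hx.1), if_pos hx.2, one_div x, Real.log_inv]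
  ring

theorem truncLog_of_one_lt {l : ℕ} (hl : 2 ≤ l) {x : ℝ} (hx : 1 < |x|) : truncLog l x = 0 := by
  have h2 : (2 : ℝ) ≤ l := by exact_mod_cast hl
  have : 1 / (l : ℝ) ≤ 1 := by
    rw [div_le_one (by linarith)]
    linarith
  rw [truncLog, if_neg (by linarith), if_neg (by linarith), mul_zero]

theorem log_natCast_pos {l : ℕ} (hl : 2 ≤ l) : 0 < Real.log l :=
  Real.log_pos (by exact_mod_cast hl)

theorem truncLog_nonneg (l : ℕ) (x : ℝ) : 0 ≤ truncLog l x := by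
  rw [truncLog]
  refine mul_nonneg (by positivity) ?_
  split_ifs with h1 h2
  · positivity
  · refine div_nonneg ?_ (by positivity)
    rw [one_div, Real.log_inv, neg_nonneg]
    exact Real.log_nonpos (abs_nonneg _) h2
  · exact le_rfl

theorem truncLog_le {l : ℕ} (hl : 2 ≤ l) (x : ℝ) :
    truncLog l x ≤ Real.sqrt (Real.log l) / Real.sqrt Real.pi := by
  have hL := log_natCast_pos hl
  have hl0 : (0 : ℝ) < l := by positivity
  rw [← truncLog_abs]
  rcases le_or_gt |x| (1 / l) with h1 | h1
  · rw [truncLog_of_le (by rwa [abs_abs])]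
  rcases le_or_gt |x| 1 with h2 | h2
  · rw [truncLog_of_mem_Ioc ⟨h1, h2⟩, div_le_div_iff₀ (by positivity) (by positivity)]
    have h3 : -Real.log |x| ≤ Real.log l := by
      rw [← Real.log_inv]
      refine Real.log_le_log (inv_pos.2 (lt_trans (by positivity) h1)) ?_
      rw [inv_le_comm₀ (lt_trans (by positivity) h1) hl0, ← one_div]
      exact h1.le
    calc _ ≤ Real.log l * Real.sqrt Real.pi := by gcongr
      _ = Real.sqrt (Real.log l) * Real.sqrt (Real.log l) * Real.sqrt Real.pi := by
        rw [Real.mul_self_sqrt hL.le]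
      _ = _ := by ring
  · rw [truncLog_of_one_lt hl (by rwa [abs_abs])]
    positivity

theorem abs_truncLog_le_indicator {l : ℕ} (hl : 2 ≤ l) (x : ℝ) :
    |truncLog l x| ≤ (Set.Icc (-1 : ℝ) 1).indicator
      (fun _ => Real.sqrt (Real.log l) / Real.sqrt Real.pi) x := by
  rw [abs_of_nonneg (truncLog_nonneg l x)]
  by_cases hx : x ∈ Set.Icc (-1 : ℝ) 1
  · rw [Set.indicator_of_mem hx]
    exact truncLog_le hl x
  · rw [Set.indicator_of_notMem hx, truncLog_of_one_lt hl]
    rw [Set.mem_Icc, ← abs_le] at hx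
    exact not_le.1 hx

theorem memLp_truncLog {l : ℕ} (hl : 2 ≤ l) (p : ENNReal) : MemLp (truncLog l) p volume := by
  refine MemLp.mono (memLp_indicator_const p (measurableSet_Icc (a := (-1 : ℝ)) (b := 1))
    (Real.sqrt (Real.log l) / Real.sqrt Real.pi) (Or.inr ?_))
    (measurable_truncLog l).aestronglyMeasurable (Eventually.of_forall fun x =>
      (abs_truncLog_le_indicator hl x).trans (le_abs_self _))
  simp

theorem integrable_truncLog {l : ℕ} (hl : 2 ≤ l) : Integrable (truncLog l) :=
  memLp_one_iff_integrable.1 (memLp_truncLog hl 1)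

theorem integral_log_mul_cos {a k : ℝ} (ha : 0 < a) (ha1 : a ≤ 1) (hk : 0 < k) :
    ∫ x in a..1, Real.log x * Real.cos (k * x) =
      -(Real.log a * Real.sin (k * a) / k) - (∫ s in (k * a)..k, Real.sin s / s) / k := by
  have hpos {x : ℝ} (hx : x ∈ Set.uIcc a 1) : 0 < x := by
    rw [Set.uIcc_of_le ha1] at hx
    exact ha.trans_le hx.1
  have hc : ∫ s in (k * a)..k, Real.sin s / s = ∫ x in a..1, Real.sin (k * x) / x := by
    have := intervalIntegral.integral_comp_mul_left (a := a) (b := 1)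
      (fun s => Real.sin s / s) hk.ne'
    rw [mul_one, smul_eq_mul, eq_inv_mul_iff_mul_eq₀ hk.ne', ← intervalIntegral.integral_const_mul]
      at this
    rw [← this]
    refine intervalIntegral.integral_congr fun x hx => ?_
    have := hpos hx
    field_simp
  have h := intervalIntegral.integral_mul_deriv_eq_deriv_mul (a := a) (b := 1)
    (u := Real.log) (u' := fun x => x⁻¹) (v := fun x => Real.sin (k * x) / k)
    (v' := fun x => Real.cos (k * x)) (fun x hx => Real.hasDerivAt_log (hpos hx).ne')
    (fun x _ => by
      refine ((Real.hasDerivAt_sin (k * x)).comp x ((hasDerivAt_id x).const_mul k)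
        |>.div_const k).congr_deriv ?_
      field_simp)
    (ContinuousOn.intervalIntegrable fun x hx =>
      (continuousAt_inv₀ (hpos hx).ne').continuousWithinAt)
    (Continuous.intervalIntegrable (by fun_prop) _ _)
  rw [h, hc, Real.log_one, ← intervalIntegral.integral_div]
  have : ∀ x : ℝ, x⁻¹ * (Real.sin (k * x) / k) = Real.sin (k * x) / x / k := fun x => by ring
  simp_rw [this]
  ring

/-- The cosine transform of the truncated logarithm. -/
theorem integral_truncLog_mul_cos {l : ℕ} (hl : 2 ≤ l) {k : ℝ} (hk : 0 < k) :
    ∫ x in Set.Ioi (0 : ℝ), truncLog l x * Real.cos (k * x) =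
      (∫ s in (k / l)..k, Real.sin s / s) / (Real.sqrt Real.pi * Real.sqrt (Real.log l) * k) := by
  have hL := log_natCast_pos hl
  have h2 : (2 : ℝ) ≤ l := by exact_mod_cast hl
  set a : ℝ := 1 / l with ha
  have ha0 : 0 < a := by positivity
  have ha1 : a ≤ 1 := by
    rw [ha, div_le_one (by linarith)]
    linarith
  have hint : Integrable fun x => truncLog l x * Real.cos (k * x) :=
    (integrable_truncLog hl).mul_bdd (c := 1) (by fun_prop)
      (Eventually.of_forall fun x => Real.abs_cos_le_one _)
  have e1 : ∫ x in Set.Ioi (0 : ℝ), truncLog l x * Real.cos (k * x) =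
      ∫ x in (0 : ℝ)..1, truncLog l x * Real.cos (k * x) := by
    rw [intervalIntegral.integral_of_le zero_le_one]
    refine setIntegral_eq_of_subset_of_forall_sdiff_eq_zero measurableSet_Ioi
      Set.Ioc_subset_Ioi_self fun x hx => ?_
    have h0 : 0 < x := hx.1
    have h1 : 1 < x := by
      by_contra! h
      exact hx.2 ⟨h0, h⟩
    rw [truncLog_of_one_lt hl (by rwa [abs_of_pos h0]), zero_mul]
  have e2 : ∫ x in (0 : ℝ)..a, truncLog l x * Real.cos (k * x) =
      Real.sqrt (Real.log l) / Real.sqrt Real.pi * (Real.sin (k * a) / k) := by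
    have : ∫ x in (0 : ℝ)..a, truncLog l x * Real.cos (k * x) =
        ∫ x in (0 : ℝ)..a, Real.sqrt (Real.log l) / Real.sqrt Real.pi * Real.cos (k * x) := by
      refine intervalIntegral.integral_congr fun x hx => ?_
      rw [Set.uIcc_of_le ha0.le] at hx
      rw [truncLog_of_le (by rw [abs_of_nonneg hx.1]; exact hx.2)]
    rw [this, intervalIntegral.integral_const_mul, intervalIntegral.integral_comp_mul_left _ hk.ne',
      integral_cos]
    simp only [mul_zero, Real.sin_zero, sub_zero, smul_eq_mul]
    ring
  have e3 : ∫ x in a..1, truncLog l x * Real.cos (k * x) =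
      -(∫ x in a..1, Real.log x * Real.cos (k * x)) /
        (Real.sqrt Real.pi * Real.sqrt (Real.log l)) := by
    rw [← intervalIntegral.integral_neg, ← intervalIntegral.integral_div,
      intervalIntegral.integral_of_le ha1, intervalIntegral.integral_of_le ha1]
    refine setIntegral_congr_fun measurableSet_Ioc fun x hx => ?_
    rw [truncLog_of_mem_Ioc hx]
    ring
  -- The plateau contribution cancels the boundary term at `a = 1 / l` from the integration by
  -- parts, leaving only the sine integral.
  rw [e1, ← intervalIntegral.integral_add_adjacent_intervals (b := a) hint.intervalIntegrable
    hint.intervalIntegrable, e2, e3, integral_log_mul_cos ha0 ha1 hk,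
    show Real.log a = -Real.log l by rw [ha, one_div, Real.log_inv],
    show k / l = k * a by rw [ha]; ring]
  have hs : Real.log l = Real.sqrt (Real.log l) * Real.sqrt (Real.log l) :=
    (Real.mul_self_sqrt hL.le).symm
  have hs0 : 0 < Real.sqrt (Real.log l) := Real.sqrt_pos.2 hL
  have hp0 : 0 < Real.sqrt Real.pi := Real.sqrt_pos.2 Real.pi_pos
  set s := Real.sqrt (Real.log l)
  rw [hs]
  field_simp
  ring

open FourierTransform in
theorem fourier_truncLog {l : ℕ} (hl : 2 ≤ l) (ξ : ℝ) :
    𝓕 (fun x => (truncLog l x : ℂ)) ξ =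
      ((2 * ∫ x in Set.Ioi (0 : ℝ), truncLog l x * Real.cos (2 * Real.pi * |ξ| * x) : ℝ) : ℂ) := by
  have hi := (integrable_truncLog hl).ofReal (𝕜 := ℂ)
  set e : ℝ → ℂ := fun x => Complex.exp (↑(-2 * Real.pi * x * ξ) * Complex.I) * (truncLog l x : ℂ)
    with he
  have h1 : 𝓕 (fun x => (truncLog l x : ℂ)) ξ = ∫ x, e x := by
    rw [Real.fourier_real_eq_integral_exp_smul]
    rfl
  have hei : Integrable e := by
    refine hi.bdd_mul (c := 1) (by fun_prop) (Eventually.of_forall fun x => ?_)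
    rw [Complex.norm_exp_ofReal_mul_I]
  -- Symmetrising replaces the exponential by a cosine, since `truncLog l` is even.
  have h2 : ∫ x, e x = ∫ x, (e x + e (-x)) / 2 := by
    rw [integral_div, integral_add hei hei.comp_neg, integral_neg_eq_self]
    ring
  have h3 (x : ℝ) : (e x + e (-x)) / 2 =
      ((truncLog l |x| * Real.cos (2 * Real.pi * |ξ| * |x|) : ℝ) : ℂ) := by
    have hc : Real.cos (2 * Real.pi * |ξ| * |x|) = Real.cos (2 * Real.pi * x * ξ) := by
      rw [← Real.cos_abs (2 * Real.pi * x * ξ)]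
      congr 1
      rw [abs_mul, abs_mul, abs_of_pos (by positivity : 0 < 2 * Real.pi)]
      ring
    have ht : truncLog l (-x) = truncLog l x := by rw [← truncLog_abs, abs_neg, truncLog_abs]
    rw [hc, truncLog_abs]
    simp only [he, ht]
    push_cast
    rw [Complex.cos]
    ring_nf
  rw [h1, h2]
  simp_rw [h3]
  rw [integral_complex_ofReal,
    integral_comp_abs (f := fun x => truncLog l x * Real.cos (2 * Real.pi * |ξ| * x))]

theorem norm_quarterSymbolMul_truncLog_sq {l : ℕ} (hl : 2 ≤ l) :
    ∀ᵐ ξ, ‖quarterSymbolMul (truncLog l) ξ‖ ^ 2 =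
      4 * (∫ s in (2 * Real.pi * |ξ| / l)..(2 * Real.pi * |ξ|), Real.sin s / s) ^ 2 /
        (Real.pi * Real.log l * (2 * Real.pi * |ξ|)) := by
  have h2 : MemLp (fun x => (truncLog l x : ℂ)) 2 volume := (memLp_truncLog hl 2).ofReal
  filter_upwards [fourier_toLp_ae_eq ((integrable_truncLog hl).ofReal (𝕜 := ℂ)) h2,
    Measure.ae_ne volume (0 : ℝ)] with ξ h hξ
  have hk : 0 < 2 * Real.pi * |ξ| := mul_pos (by positivity) (abs_pos.2 hξ)
  have hL := log_natCast_pos hl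
  rw [norm_quarterSymbolMul_sq, fourierL2_of_memLp h2]
  refine (congrArg (fun z : ℂ => |2 * Real.pi * ξ| * ‖z‖ ^ 2)
    (h.trans (fourier_truncLog hl ξ))).trans ?_
  rw [integral_truncLog_mul_cos hl hk, Complex.norm_real, Real.norm_eq_abs, sq_abs, abs_mul,
    abs_of_pos (by positivity : 0 < 2 * Real.pi)]
  set k := 2 * Real.pi * |ξ|
  have hs0 : 0 < Real.sqrt (Real.log l) := Real.sqrt_pos.2 hL
  have hp0 : 0 < Real.sqrt Real.pi := Real.sqrt_pos.2 Real.pi_pos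
  rw [mul_pow, div_pow, mul_pow, mul_pow, Real.sq_sqrt hL.le, Real.sq_sqrt Real.pi_pos.le]
  field_simp
  ring

/-! ### The norm of the truncated logarithm -/

/-- Pointwise majorant of `‖|2πξ|^{1/2} ω̂(ξ)‖²` as a function of `r = |ξ|`, up to the factor
`1 / log l`. -/
def symbolMajorant (l : ℕ) (r : ℝ) : ℝ :=
  (Set.Ioc (0 : ℝ) 1).indicator (fun r => 8 * r) r +
    (Set.Ioc (1 : ℝ) l).indicator (fun r => 1 / 2 * r⁻¹) r +
    (Set.Ioi (1 : ℝ)).indicator (fun r => r ^ (-2 : ℝ)) r +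
    (Set.Ioi (l : ℝ)).indicator (fun r => (l : ℝ) ^ 2 * r ^ (-3 : ℝ)) r

theorem integrableOn_symbolMajorant {l : ℕ} (hl : 2 ≤ l) :
    IntegrableOn (symbolMajorant l) (Set.Ioi 0) ∧
      ∫ r in Set.Ioi (0 : ℝ), symbolMajorant l r = 11 / 2 + Real.log l / 2 := by
  have h2 : (2 : ℝ) ≤ l := by exact_mod_cast hl
  have s2 : Set.Ioc (1 : ℝ) l ⊆ Set.Ioi 0 := fun x hx => zero_lt_one.trans hx.1
  have s3 : Set.Ioi (1 : ℝ) ⊆ Set.Ioi 0 := Set.Ioi_subset_Ioi zero_le_one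
  have s4 : Set.Ioi (l : ℝ) ⊆ Set.Ioi 0 := Set.Ioi_subset_Ioi (by linarith)
  have i1 : Integrable ((Set.Ioc (0 : ℝ) 1).indicator fun r => 8 * r) :=
    (integrable_indicator_iff measurableSet_Ioc).2
      ((Continuous.integrableOn_Icc (by fun_prop)).mono_set Set.Ioc_subset_Icc_self)
  have i2 : Integrable ((Set.Ioc (1 : ℝ) l).indicator fun r => 1 / 2 * r⁻¹) := by
    refine (integrable_indicator_iff measurableSet_Ioc).2 (Integrable.const_mul ?_ _)
    refine IntegrableOn.mono_set (ContinuousOn.integrableOn_Icc fun x hx => ?_)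
      Set.Ioc_subset_Icc_self
    exact (continuousAt_inv₀ (zero_lt_one.trans_le hx.1).ne').continuousWithinAt
  have i3 : Integrable ((Set.Ioi (1 : ℝ)).indicator fun r => r ^ (-2 : ℝ)) :=
    (integrable_indicator_iff measurableSet_Ioi).2
      (integrableOn_Ioi_rpow_of_lt (by norm_num) one_pos)
  have i4 : Integrable ((Set.Ioi (l : ℝ)).indicator fun r => (l : ℝ) ^ 2 * r ^ (-3 : ℝ)) :=
    (integrable_indicator_iff measurableSet_Ioi).2
      (Integrable.const_mul (integrableOn_Ioi_rpow_of_lt (by norm_num) (by linarith)) _)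
  have i := ((i1.add i2).add i3).add i4
  -- The four pieces have masses `4`, `(log l) / 2`, `1` and `1 / 2`.
  refine ⟨i.integrableOn, ?_⟩
  simp only [symbolMajorant]
  rw [integral_add (by exact ((i1.add i2).add i3).integrableOn) i4.integrableOn,
    integral_add (by exact (i1.add i2).integrableOn) i3.integrableOn,
    integral_add i1.integrableOn i2.integrableOn,
    setIntegral_indicator measurableSet_Ioc, setIntegral_indicator measurableSet_Ioc,
    setIntegral_indicator measurableSet_Ioi, setIntegral_indicator measurableSet_Ioi,
    Set.inter_eq_right.2 Set.Ioc_subset_Ioi_self, Set.inter_eq_right.2 s2,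
    Set.inter_eq_right.2 s3, Set.inter_eq_right.2 s4, integral_const_mul, integral_const_mul,
    integral_const_mul, integral_Ioi_rpow_of_lt (by norm_num) one_pos,
    integral_Ioi_rpow_of_lt (by norm_num) (by linarith),
    ← intervalIntegral.integral_of_le zero_le_one,
    ← intervalIntegral.integral_of_le (by linarith), integral_inv_of_pos one_pos (by linarith),
    integral_id]
  have : (l : ℝ) ^ (-3 + 1 : ℝ) = ((l : ℝ) ^ 2)⁻¹ := by
    rw [← Real.rpow_natCast, ← Real.rpow_neg (by linarith)]
    norm_num
  rw [this, div_one]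
  have hl0 : (l : ℝ) ≠ 0 := by linarith
  norm_num
  field_simp
  ring

/-- Each regime has its own sine integral bound: the trivial one for `r ≤ 1`, the `π / 2` one for `1
< r ≤ l`, the decaying one for `r > l`. Only the middle regime produces a logarithm, so only there
does the constant matter. -/
theorem four_mul_integral_sin_div_sq_le {l : ℕ} (hl : 2 ≤ l) {r : ℝ} (hr : 0 < r) :
    4 * (∫ s in (2 * Real.pi * r / l)..(2 * Real.pi * r), Real.sin s / s) ^ 2 /
        (Real.pi * Real.log l * (2 * Real.pi * r)) ≤ symbolMajorant l r / Real.log l := by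
  have h2 : (2 : ℝ) ≤ l := by exact_mod_cast hl
  have hL := log_natCast_pos hl
  have hπ := Real.pi_gt_three
  have hπ' := Real.pi_lt_d2
  have hk : 0 < 2 * Real.pi * r := by positivity
  have ha : 0 < 2 * Real.pi * r / l := by positivity
  have hab : 2 * Real.pi * r / l ≤ 2 * Real.pi * r := div_le_self hk.le (by linarith)
  have b1 := abs_integral_sin_div_le_self ha hab
  have b2 := abs_integral_sin_div_le_pi ha hab
  have b3 := abs_integral_sin_div_le_inv ha hab
  set S := ∫ s in (2 * Real.pi * r / l)..(2 * Real.pi * r), Real.sin s / s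
  have e : 4 * S ^ 2 / (Real.pi * Real.log l * (2 * Real.pi * r)) =
      (2 * S ^ 2 / (Real.pi ^ 2 * r)) / Real.log l := by
    field_simp
    ring
  rw [e]
  gcongr
  rw [div_le_iff₀ (by positivity), ← sq_abs]
  simp only [symbolMajorant]
  rcases le_or_gt r 1 with h | h
  · rw [Set.indicator_of_mem (show r ∈ Set.Ioc (0 : ℝ) 1 from ⟨hr, h⟩),
      Set.indicator_of_notMem (s := Set.Ioc (1 : ℝ) l) (fun h' => h'.1.not_ge h),
      Set.indicator_of_notMem (s := Set.Ioi (1 : ℝ)) (fun h' => (show 1 < r from h').not_ge h),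
      Set.indicator_of_notMem (s := Set.Ioi (l : ℝ))
        (fun h' => by linarith [show (l : ℝ) < r from h'])]
    have := pow_le_pow_left₀ (abs_nonneg S) b1 2
    nlinarith
  rw [Set.indicator_of_notMem (s := Set.Ioc (0 : ℝ) 1) (fun h' => h'.2.not_gt h),
    Set.indicator_of_mem (show r ∈ Set.Ioi (1 : ℝ) from h)]
  have r2 : r ^ (-2 : ℝ) = (r ^ 2)⁻¹ := by
    rw [Real.rpow_neg hr.le]
    norm_num
  have r3 : r ^ (-3 : ℝ) = (r ^ 3)⁻¹ := by
    rw [Real.rpow_neg hr.le]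
    norm_num
  rw [r2]
  rcases le_or_gt r l with h' | h'
  · rw [Set.indicator_of_mem (show r ∈ Set.Ioc (1 : ℝ) l from ⟨h, h'⟩),
      Set.indicator_of_notMem (s := Set.Ioi (l : ℝ)) (fun h'' => (show (l : ℝ) < r from h'').not_ge h')]
    have c1 : |S| ≤ Real.pi / 2 + 1 / r := b2.trans (by
      gcongr
      nlinarith)
    have c2 := pow_le_pow_left₀ (abs_nonneg S) c1 2
    -- The goal reduces to `2 (π / 2 + 1 / r)² ≤ π² / 2 + π² / r`, which follows from `r⁻² ≤ r⁻¹`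
    -- and `π² ≥ 2 π + 2`.
    have hi : r⁻¹ * r⁻¹ ≤ r⁻¹ := by
      have : r⁻¹ ≤ 1 := inv_le_one_of_one_le₀ h.le
      nlinarith [inv_pos.2 hr]
    have e1 : (0 + 1 / 2 * r⁻¹ + (r ^ 2)⁻¹ + 0) * (Real.pi ^ 2 * r) =
        Real.pi ^ 2 / 2 + Real.pi ^ 2 * r⁻¹ := by
      field_simp
      ring
    rw [e1]
    rw [one_div] at c2
    nlinarith [inv_pos.2 hr, mul_pos (inv_pos.2 hr) (show (0 : ℝ) < Real.pi ^ 2 - 2 * Real.pi - 2 by nlinarith)]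
  · rw [Set.indicator_of_notMem (s := Set.Ioc (1 : ℝ) l) (fun h'' => h''.2.not_gt h'),
      Set.indicator_of_mem (show r ∈ Set.Ioi (l : ℝ) from h'), r3]
    have c1 : |S| ≤ l / r := by
      refine b3.trans ?_
      rw [one_div_div, ← add_div, div_le_div_iff₀ hk hr]
      calc ((l : ℝ) + 1) * r ≤ (2 * l) * r := by gcongr; linarith
        _ ≤ (2 * l) * r * Real.pi := le_mul_of_one_le_right (by positivity) (by linarith)
        _ = _ := by ring
    have c2 := pow_le_pow_left₀ (abs_nonneg S) c1 2
    have e1 : (0 + 0 + (r ^ 2)⁻¹ + (l : ℝ) ^ 2 * (r ^ 3)⁻¹) * (Real.pi ^ 2 * r) =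
        Real.pi ^ 2 * r⁻¹ + Real.pi ^ 2 * (l / r) ^ 2 := by
      field_simp
      ring
    rw [e1]
    have p2 : 2 ≤ Real.pi ^ 2 := by nlinarith
    calc 2 * |S| ^ 2 ≤ Real.pi ^ 2 * (l / r) ^ 2 := by gcongr
      _ ≤ _ := le_add_of_nonneg_left (by positivity)

theorem memLp_quarterSymbolMul_truncLog {l : ℕ} (hl : 2 ≤ l) :
    MemLp (quarterSymbolMul (truncLog l)) 2 volume ∧
      ∫ ξ, ‖quarterSymbolMul (truncLog l) ξ‖ ^ 2 ≤ 1 + 11 / Real.log l := by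
  have hL := log_natCast_pos hl
  have hm : AEStronglyMeasurable (quarterSymbolMul (truncLog l)) volume :=
    (Complex.measurable_ofReal.comp (by fun_prop)).aestronglyMeasurable.mul
      (memLp_fourierL2 (memLp_truncLog hl 2)).1
  obtain ⟨i, hi⟩ := integrableOn_symbolMajorant hl
  have ib : Integrable fun ξ : ℝ => symbolMajorant l |ξ| / Real.log l :=
    (integrable_comp_abs i).div_const _
  have hle : ∀ᵐ ξ, ‖quarterSymbolMul (truncLog l) ξ‖ ^ 2 ≤ symbolMajorant l |ξ| / Real.log l := by
    filter_upwards [norm_quarterSymbolMul_truncLog_sq hl, Measure.ae_ne volume (0 : ℝ)] with ξ h hξ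
    rw [h]
    exact four_mul_integral_sin_div_sq_le hl (abs_pos.2 hξ)
  have iq : Integrable fun ξ => ‖quarterSymbolMul (truncLog l) ξ‖ ^ 2 :=
    ib.mono' (hm.norm.pow 2) (by
      filter_upwards [hle] with ξ h
      rwa [Real.norm_eq_abs, abs_of_nonneg (by positivity)])
  refine ⟨(memLp_two_iff_integrable_sq_norm hm).2 iq, (integral_mono_ae iq ib hle).trans_eq ?_⟩
  rw [integral_div, integral_comp_abs, hi]
  field_simp
  ring

theorem truncLog_mem_HHalf {l : ℕ} (hl : 2 ≤ l) : truncLog l ∈ HHalf :=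
  ⟨memLp_truncLog hl 2, (memLp_quarterSymbolMul_truncLog hl).1⟩

/-- On `0 < |x| ≤ 1` the function is at most `-log |x| / √(π log l)`, and `log² |x| ≤ 16 |x|^{-1/2}`
is integrable there. Each half-line contributes at most `32 / log l`. -/
theorem integral_truncLog_sq_le {l : ℕ} (hl : 2 ≤ l) :
    ∫ x, truncLog l x * truncLog l x ≤ 64 / Real.log l := by
  have hL := log_natCast_pos hl
  set φ : ℝ → ℝ := (Set.Ioc (0 : ℝ) 1).indicator fun x => 16 * x ^ (-(1 / 2) : ℝ) with hφ
  have i0 : IntervalIntegrable (fun x : ℝ => x ^ (-(1 / 2) : ℝ)) volume 0 1 :=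
    intervalIntegral.intervalIntegrable_rpow' (by norm_num)
  have i1 : IntegrableOn φ (Set.Ioi 0) := by
    refine ((integrable_indicator_iff measurableSet_Ioc).2 ?_).integrableOn
    refine Integrable.const_mul ?_ _
    exact (intervalIntegrable_iff_integrableOn_Ioc_of_le zero_le_one).1 i0
  have e : ∫ x in Set.Ioi (0 : ℝ), φ x = 32 := by
    rw [hφ, setIntegral_indicator measurableSet_Ioc, Set.inter_eq_right.2 Set.Ioc_subset_Ioi_self,
      integral_const_mul, ← intervalIntegral.integral_of_le zero_le_one,
      integral_rpow (Or.inl (by norm_num))]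
    norm_num
  have ib : Integrable fun x : ℝ => φ |x| / Real.log l := (integrable_comp_abs i1).div_const _
  have h := memLp_truncLog hl 2
  calc ∫ x, truncLog l x * truncLog l x ≤ ∫ x, φ |x| / Real.log l := by
        refine integral_mono_ae (h.integrable_mul h) ib ?_
        filter_upwards [Measure.ae_ne volume (0 : ℝ)] with x hx
        have hx0 := abs_pos.2 hx
        rcases le_or_gt |x| 1 with h1 | h1
        · rw [hφ, Set.indicator_of_mem (show |x| ∈ Set.Ioc (0 : ℝ) 1 from ⟨hx0, h1⟩)]
          have hlog : -Real.log |x| ≤ 4 * |x| ^ (-(1 / 4) : ℝ) := by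
            have := Real.log_le_rpow_div (inv_nonneg.2 hx0.le) (ε := 1 / 4) (by norm_num)
            rw [Real.log_inv, Real.inv_rpow hx0.le, ← Real.rpow_neg hx0.le] at this
            linarith
          have hlog0 : 0 ≤ -Real.log |x| := neg_nonneg.2 (Real.log_nonpos hx0.le h1)
          have hsq : Real.log |x| ^ 2 ≤ 16 * |x| ^ (-(1 / 2) : ℝ) := by
            have := pow_le_pow_left₀ hlog0 hlog 2
            rw [mul_pow, ← Real.rpow_natCast (|x| ^ (-(1 / 4) : ℝ)), ← Real.rpow_mul hx0.le] at this
            norm_num at this ⊢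
            exact this
          have ht : truncLog l x ^ 2 ≤ Real.log |x| ^ 2 / (Real.pi * Real.log l) := by
            have hs : truncLog l x ≤
                -Real.log |x| / (Real.sqrt Real.pi * Real.sqrt (Real.log l)) := by
              rcases le_or_gt |x| (1 / l) with h2 | h2
              · rw [truncLog_of_le h2, div_le_div_iff₀ (by positivity) (by positivity)]
                have h3 : Real.log l ≤ -Real.log |x| := by
                  rw [← Real.log_inv]
                  refine Real.log_le_log (by positivity) ?_
                  rw [le_inv_comm₀ (by positivity) hx0, ← one_div]
                  exact h2
                calc _ = Real.sqrt (Real.log l) * Real.sqrt (Real.log l) * Real.sqrt Real.pi := by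
                      ring
                  _ = Real.log l * Real.sqrt Real.pi := by rw [Real.mul_self_sqrt hL.le]
                  _ ≤ _ := by gcongr
              · rw [← truncLog_abs, truncLog_of_mem_Ioc ⟨h2, h1⟩]
            have := pow_le_pow_left₀ (truncLog_nonneg l x) hs 2
            rwa [div_pow, mul_pow, Real.sq_sqrt hL.le, Real.sq_sqrt Real.pi_pos.le, neg_sq] at this
          rw [← sq]
          refine ht.trans ?_
          rw [mul_comm Real.pi, ← div_div, div_right_comm]
          gcongr
          refine (div_le_self (by positivity) ?_).trans hsq
          linarith [Real.pi_gt_three]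
        · rw [truncLog_of_one_lt hl h1, hφ,
            Set.indicator_of_notMem (s := Set.Ioc (0 : ℝ) 1) fun h2 => h2.2.not_gt h1]
          simp
    _ = _ := by
        rw [integral_div, integral_comp_abs, e]
        norm_num

theorem innerHalf_truncLog_le {l : ℕ} (hl : 2 ≤ l) :
    innerHalf (truncLog l) (truncLog l) ≤ 1 + 75 / Real.log l := by
  have h1 := integral_truncLog_sq_le hl
  obtain ⟨h2, h3⟩ := memLp_quarterSymbolMul_truncLog hl
  have h4 := integral_quarterLaplacian_sq_le h2
  have : 1 + 75 / Real.log l = (1 + 11 / Real.log l) + 64 / Real.log l := by ring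
  rw [this]
  exact add_le_add (h4.trans h3) h1

/-- The plateau alone has positive `L²` mass; this makes the normalisation in `moser` genuine. -/
theorem innerHalf_truncLog_pos {l : ℕ} (hl : 2 ≤ l) :
    0 < innerHalf (truncLog l) (truncLog l) := by
  have hL := log_natCast_pos hl
  have hl0 : (0 : ℝ) < l := by positivity
  have h := memLp_truncLog hl 2
  refine add_pos_of_nonneg_of_pos (integral_nonneg fun _ => mul_self_nonneg _) ?_
  have h1 : ∫ x in Set.Icc (-(1 / (l : ℝ))) (1 / l), truncLog l x * truncLog l x ≤
      ∫ x, truncLog l x * truncLog l x :=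
    setIntegral_le_integral (h.integrable_mul h) (Eventually.of_forall fun _ => mul_self_nonneg _)
  refine lt_of_lt_of_le ?_ h1
  have h2 : ∫ x in Set.Icc (-(1 / (l : ℝ))) (1 / l), truncLog l x * truncLog l x =
      ∫ x in Set.Icc (-(1 / (l : ℝ))) (1 / l), Real.log l / Real.pi := by
    refine setIntegral_congr_fun measurableSet_Icc fun x hx => ?_
    rw [truncLog_of_le (abs_le.2 hx), div_mul_div_comm, Real.mul_self_sqrt hL.le,
      Real.mul_self_sqrt Real.pi_pos.le]
  rw [h2, setIntegral_const, smul_eq_mul, Real.volume_real_Icc]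
  have : 0 < 1 / (l : ℝ) - -(1 / l) := by
    have : 0 < 1 / (l : ℝ) := by positivity
    linarith
  exact mul_pos (lt_max_of_lt_left this) (by positivity)

/-! ### Growth of the nonlinearities and their primitives -/

namespace IsNonlinearity

variable {α₀ θ : ℝ} {f : ℝ → ℝ}

theorem continuous_primitive (hf : IsNonlinearity α₀ θ f) : Continuous (primitive f) :=
  intervalIntegral.continuous_primitive (fun a b => hf.continuous.intervalIntegrable a b) 0

theorem primitive_of_nonpos (hf : IsNonlinearity α₀ θ f) {t : ℝ} (ht : t ≤ 0) :
    primitive f t = 0 := by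
  have h : ∫ s in (0 : ℝ)..t, f s = ∫ _ in (0 : ℝ)..t, (0 : ℝ) := by
    refine intervalIntegral.integral_congr fun s hs => ?_
    rw [Set.uIcc_of_ge ht] at hs
    exact hf.zero_of_nonpos s hs.2
  rw [primitive, h, intervalIntegral.integral_zero]

theorem primitive_mono (hf : IsNonlinearity α₀ θ f) : Monotone (primitive f) := by
  intro a b hab
  have h := intervalIntegral.integral_interval_sub_left (hf.continuous.intervalIntegrable 0 b)
    (hf.continuous.intervalIntegrable 0 a) (μ := volume)
  have h2 : 0 ≤ ∫ s in a..b, f s := intervalIntegral.integral_nonneg hab fun s _ => hf.nonneg s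
  rw [primitive, primitive]
  linarith

theorem primitive_nonneg (hf : IsNonlinearity α₀ θ f) (t : ℝ) : 0 ≤ primitive f t := by
  rw [← hf.primitive_of_nonpos (min_le_right t 0)]
  exact hf.primitive_mono (min_le_left t 0)

/-- (H2) handles small `t`, compactness the middle range, and critical growth with exponent `2 α₀ >
α₀` large `t`. The factor `t` matters near 0: it produces the `u²` that is integrable on the whole
line. -/
theorem exists_le_mul_exp (hα₀ : 0 < α₀) (hf : IsNonlinearity α₀ θ f) :
    ∃ C : ℝ, 0 ≤ C ∧ ∀ t, 0 ≤ t → f t ≤ C * t * Real.exp (2 * α₀ * t ^ 2) := by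
  obtain ⟨δ, hδ, hnear⟩ := Metric.eventually_nhds_iff.1 (hf.near_zero.bound one_pos)
  obtain ⟨M, hM⟩ := eventually_atTop.1
    ((hf.critical.1 (2 * α₀) (by linarith)).eventually_le_const one_pos)
  obtain ⟨B, hB⟩ := (isCompact_Icc (a := (0 : ℝ)) (b := max M 1)).bddAbove_image
    hf.continuous.continuousOn
  have hB' : ∀ t, 0 ≤ t → t ≤ max M 1 → f t ≤ B := fun t h0 h1 =>
    hB (Set.mem_image_of_mem f ⟨h0, h1⟩)
  have hB0 : 0 ≤ B := (hf.nonneg 0).trans (hB' 0 le_rfl (by positivity))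
  refine ⟨1 + B / δ, by positivity, fun t ht => ?_⟩
  have he : 1 ≤ Real.exp (2 * α₀ * t ^ 2) := Real.one_le_exp (by positivity)
  have hBt : 0 ≤ B / δ * t := by positivity
  rcases lt_or_ge t δ with h1 | h1
  · have h2 := hnear (show dist t 0 < δ by rwa [Real.dist_0_eq_abs, abs_of_nonneg ht])
    rw [one_mul, Real.norm_eq_abs, Real.norm_eq_abs, abs_of_nonneg ht,
      abs_of_nonneg (hf.nonneg t)] at h2
    nlinarith
  rcases le_or_gt t (max M 1) with h2 | h2
  · have h3 : B ≤ B / δ * t := by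
      rw [div_mul_eq_mul_div, le_div_iff₀ hδ]
      gcongr
    have h4 := hB' t ht h2
    nlinarith
  · have ht1 : 1 < t := (le_max_right _ _).trans_lt h2
    have h3 := hM t ((le_max_left _ _).trans h2.le)
    have h4 : 0 < Real.exp (2 * α₀ * t ^ 2) - 1 :=
      sub_pos.2 (Real.one_lt_exp_iff.2 (by positivity))
    rw [div_le_one h4] at h3
    nlinarith

theorem exists_primitive_le (hα₀ : 0 < α₀) (hθ : 2 < θ) (hf : IsNonlinearity α₀ θ f) :
    ∃ C : ℝ, 0 ≤ C ∧ ∀ t, primitive f t ≤ C * (t ^ 2 * Real.exp (2 * α₀ * t ^ 2)) := by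
  obtain ⟨C, hC0, hC⟩ := hf.exists_le_mul_exp hα₀
  refine ⟨C, hC0, fun t => ?_⟩
  rcases le_or_gt t 0 with ht | ht
  · rw [hf.primitive_of_nonpos ht]
    positivity
  · have h1 := (hf.ambrosetti_rabinowitz t ht).2
    have h2 := mul_le_mul_of_nonneg_left (hC t ht.le) ht.le
    have h3 := hf.primitive_nonneg t
    nlinarith

/-- The primitive dominates any multiple of `e^{α₀ s²} / s²` at infinity. -/
theorem exists_le_primitive (hα₀ : 0 < α₀) (hf : IsNonlinearity α₀ θ f) {K : ℝ} (hK : 0 ≤ K) :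
    ∃ s₀ : ℝ, ∀ s, s₀ ≤ s → K * Real.exp (α₀ * s ^ 2) / s ^ 2 ≤ primitive f s := by
  -- On the window `[s - 1 / s, s]` one has `r² ≥ s² - 2`; the factor `e^{2 α₀}` pays for this loss,
  -- and the window length supplies the second `1 / s`.
  obtain ⟨M, hM⟩ := eventually_atTop.1
    (hf.asymptotic.eventually_ge_atTop (K * Real.exp (2 * α₀)))
  refine ⟨max M 0 + 1, fun s hs => ?_⟩
  have hs1 : 1 ≤ s := by linarith [le_max_right M 0]
  have hsM : M ≤ s - 1 := by linarith [le_max_left M 0]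
  have hs0 : 0 < s := by linarith
  have hinv : 1 / s ≤ 1 := by rw [div_le_one hs0]; exact hs1
  have hinv0 : 0 < 1 / s := by positivity
  have hlow : ∀ r ∈ Set.Icc (s - 1 / s) s, K * Real.exp (α₀ * s ^ 2) / s ≤ f r := by
    intro r hr
    -- `r = 0` can occur only for `s = 1`; the asymptotic bound at 0 then forces `K = 0`.
    rcases (show 0 ≤ r by linarith [hr.1]).eq_or_lt with h0 | h0
    · subst h0
      have := hM 0 (by linarith [hr.1])
      simp only [zero_mul] at this
      have hK0 : K ≤ 0 := by
        by_contra! h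
        exact absurd this (not_le.2 (by positivity))
      rw [le_antisymm hK0 hK]
      simpa using hf.nonneg 0
    have h1 := hM r (by linarith [hr.1])
    have h2 : s ^ 2 - 2 ≤ r ^ 2 := by
      have e : s * (1 / s) = 1 := by field_simp
      have := pow_le_pow_left₀ (by linarith) hr.1 2
      nlinarith
    have h3 : K * Real.exp (2 * α₀) * Real.exp (α₀ * r ^ 2) ≤ r * f r := by
      have := mul_le_mul_of_nonneg_right h1 (Real.exp_pos (α₀ * r ^ 2)).le
      rwa [mul_assoc (r * f r), ← Real.exp_add, show -α₀ * r ^ 2 + α₀ * r ^ 2 = 0 by ring,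
        Real.exp_zero, mul_one] at this
    have h4 : K * Real.exp (α₀ * s ^ 2) ≤ K * Real.exp (2 * α₀) * Real.exp (α₀ * r ^ 2) := by
      rw [mul_assoc, ← Real.exp_add]
      gcongr
      nlinarith
    rw [div_le_iff₀ hs0, mul_comm (f r)]
    exact (h4.trans h3).trans (mul_le_mul_of_nonneg_right hr.2 (hf.nonneg r))
  have h5 : K * Real.exp (α₀ * s ^ 2) / s ^ 2 ≤ ∫ r in (s - 1 / s)..s, f r := by
    have := intervalIntegral.integral_mono_on (a := s - 1 / s) (b := s) (by linarith)
      (intervalIntegrable_const (c := K * Real.exp (α₀ * s ^ 2) / s)) (μ := volume)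
      (hf.continuous.intervalIntegrable _ _) hlow
    rw [intervalIntegral.integral_const, smul_eq_mul] at this
    refine le_trans (le_of_eq ?_) this
    field_simp
    ring
  have h6 := intervalIntegral.integral_interval_sub_left (hf.continuous.intervalIntegrable 0 s)
    (hf.continuous.intervalIntegrable 0 (s - 1 / s)) (μ := volume)
  have h7 := hf.primitive_nonneg (s - 1 / s)
  rw [primitive] at h7 ⊢
  linarith

end IsNonlinearity

/-! ### Energy estimates along the Moser functions -/

theorem IsWeight.exists_bound {P : ℝ → ℝ} (hP : IsWeight P) : ∃ C, ∀ x, ‖P x‖ ≤ C := by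
  let Φ : ZeroAtInftyContinuousMap ℝ ℝ := ⟨⟨P, hP.continuous⟩, hP.vanishing⟩
  exact ⟨‖Φ.toBCF‖, fun x => Φ.toBCF.norm_coe_le_norm x⟩

theorem IsWeight.integrable_mul_primitive {α₀ θ : ℝ} (hα₀ : 0 < α₀) (hθ : 2 < θ) {P f u : ℝ → ℝ}
    (hP : IsWeight P) (hf : IsNonlinearity α₀ θ f) (hu : u ∈ HHalf) :
    Integrable fun x => P x * primitive f (u x) := by
  obtain ⟨B, hB⟩ := hP.exists_bound
  obtain ⟨C, hC0, hC⟩ := hf.exists_primitive_le hα₀ hθ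
  have hi : Integrable fun x => primitive f (u x) := by
    refine ((integrable_sq_mul_exp hu (β := 2 * α₀) (by positivity)).const_mul C).mono'
      (hf.continuous_primitive.comp_aestronglyMeasurable hu.1.1) (Eventually.of_forall fun x => ?_)
    rw [Real.norm_eq_abs, abs_of_nonneg (hf.primitive_nonneg _)]
    exact hC (u x)
  exact hi.bdd_mul (c := B) hP.continuous.aestronglyMeasurable (Eventually.of_forall hB)

theorem moser_eq_smul (l : ℕ) : moser l = (normHalf (truncLog l))⁻¹ • truncLog l := by
  ext x
  rw [moser, Pi.smul_apply, smul_eq_mul, div_eq_inv_mul]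

theorem moser_mem_HHalf {l : ℕ} (hl : 2 ≤ l) : moser l ∈ HHalf := by
  rw [moser_eq_smul]
  exact HHalf.smul (truncLog_mem_HHalf hl) _

theorem innerHalf_moser {l : ℕ} (hl : 2 ≤ l) : innerHalf (moser l) (moser l) = 1 := by
  have h := innerHalf_truncLog_pos hl
  rw [moser_eq_smul, innerHalf_smul_self (truncLog_mem_HHalf hl), normHalf, inv_pow,
    Real.sq_sqrt h.le, inv_mul_cancel₀ h.ne']

/-- On `|x| ≤ 1 / l` one of `t m + u`, `t m - u` is at least `t m`, which bounds the energy by a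
function of `t` alone. -/
theorem energy_le {α₀ θ : ℝ} (hα₀ : 0 < α₀) (hθ : 2 < θ) {P Q f g : ℝ → ℝ}
    (hP : IsWeight P) (hQ : IsWeight Q)
    (hf : IsNonlinearity α₀ θ f) (hg : IsNonlinearity α₀ θ g) {l : ℕ} (hl : 2 ≤ l) {c : ℝ}
    (hPc : ∀ x : ℝ, |x| ≤ 1 / l → c ≤ P x) (hQc : ∀ x : ℝ, |x| ≤ 1 / l → c ≤ Q x) {s t B : ℝ}
    (hs : ∀ x : ℝ, |x| ≤ 1 / l → s ≤ t * moser l x) (hB0 : 0 ≤ B)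
    (hfB : B ≤ primitive f s) (hgB : B ≤ primitive g s)
    {u : ℝ → ℝ} (hu : u ∈ HHalf) :
    energy P Q f g (t • (moser l, moser l) + (u, -u)) ≤ t ^ 2 - 2 / l * (c * B) := by
  have hm := moser_mem_HHalf hl
  have h1 : t • moser l + u ∈ HHalf := by simpa using HHalf.linear hm hu t 1
  have h2 : t • moser l - u ∈ HHalf := by
    simpa [sub_eq_add_neg] using HHalf.linear hm hu t (-1)
  have i1 := hP.integrable_mul_primitive hα₀ hθ hf h1
  have i2 := hQ.integrable_mul_primitive hα₀ hθ hg h2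
  have e : t • (moser l, moser l) + (u, -u) = (t • moser l + u, t • moser l - u) := by
    simp [sub_eq_add_neg]
  rw [e, energy, innerHalf_add_sub hm hu, innerHalf_moser hl, mul_one, sub_sub,
    ← integral_add i1 i2]
  have hn := innerHalf_self_nonneg u
  set Φ : ℝ → ℝ := fun x =>
    P x * primitive f ((t • moser l + u) x) + Q x * primitive g ((t • moser l - u) x) with hΦ
  have hΦ0 (x : ℝ) : 0 ≤ Φ x := add_nonneg (mul_nonneg (hP.nonneg x) (hf.primitive_nonneg _))
    (mul_nonneg (hQ.nonneg x) (hg.primitive_nonneg _))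
  have hlow : 2 / l * (c * B) ≤ ∫ x, Φ x := by
    have hl0 : (0 : ℝ) < 1 / l := by positivity
    calc 2 / l * (c * B) = ∫ x in Set.Icc (-(1 / (l : ℝ))) (1 / l), c * B := by
          rw [setIntegral_const, smul_eq_mul, Real.volume_real_Icc_of_le (by linarith)]
          ring
      _ ≤ ∫ x in Set.Icc (-(1 / (l : ℝ))) (1 / l), Φ x := by
          refine setIntegral_mono_on (integrableOn_const (by simp)) (i1.add i2).integrableOn
            measurableSet_Icc fun x hx => ?_
          have hx' : |x| ≤ 1 / l := abs_le.2 hx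
          have hsx := hs x hx'
          simp only [hΦ, Pi.add_apply, Pi.sub_apply, Pi.smul_apply, smul_eq_mul]
          have hp := hP.nonneg x
          have hq := hQ.nonneg x
          rcases le_total 0 (u x) with h | h
          · have h3 : B ≤ primitive f (t * moser l x + u x) :=
              hfB.trans (hf.primitive_mono (by linarith))
            have h4 := mul_le_mul (hPc x hx') h3 hB0 hp
            have h5 := mul_nonneg hq (hg.primitive_nonneg (t * moser l x - u x))
            linarith
          · have h3 : B ≤ primitive g (t * moser l x - u x) :=
              hgB.trans (hg.primitive_mono (by linarith))
            have h4 := mul_le_mul (hQc x hx') h3 hB0 hq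
            have h5 := mul_nonneg hp (hf.primitive_nonneg (t * moser l x + u x))
            linarith
      _ ≤ ∫ x, Φ x := setIntegral_le_integral (i1.add i2) (Eventually.of_forall hΦ0)
  linarith

/-- For `τ ≤ 1` the linear term is at most `A` and the exponential is smallest at `τ = 1 / 2`. For
`τ = 1 + δ`, dividing by `τ ≤ e^δ` leaves at least `1 + δ (L - 76) ≥ 1 + δ L / 4`, which is where `L
≥ 102` enters; the gain `D δ / 4` then beats the excess `A δ`. -/
theorem mul_sub_exp_div_le {A D L τ : ℝ} (hA : 0 < A) (hD : 4 * A ≤ D) (hL : 102 ≤ L)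
    (hτ : 1 / 2 ≤ τ) :
    A * τ - D / L * (Real.exp ((τ - 1) * (L - 75)) / τ) ≤
      A - D / L * Real.exp (-(L - 75) / 2) := by
  have hτ0 : 0 < τ := by linarith
  have hL0 : 0 < L := by linarith
  have hDL : 0 < D / L := div_pos (by linarith) hL0
  rcases le_total τ 1 with h | h
  · have h1 : Real.exp (-(L - 75) / 2) ≤ Real.exp ((τ - 1) * (L - 75)) / τ := by
      rw [le_div_iff₀ hτ0]
      calc Real.exp (-(L - 75) / 2) * τ ≤ Real.exp (-(L - 75) / 2) :=
            mul_le_of_le_one_right (Real.exp_pos _).le h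
        _ ≤ _ := Real.exp_le_exp.2 (by nlinarith)
    have h2 := mul_le_mul_of_nonneg_left h1 hDL.le
    nlinarith
  · set δ := τ - 1 with hδ
    have hδ0 : 0 ≤ δ := by linarith
    have h1 : 1 + δ * L / 4 ≤ Real.exp (δ * (L - 75)) / τ := by
      rw [le_div_iff₀ hτ0]
      have e1 := Real.add_one_le_exp δ
      have e2 := Real.add_one_le_exp (δ * (L - 76))
      have e3 : 1 + δ * L / 4 ≤ Real.exp (δ * (L - 76)) := by nlinarith
      calc (1 + δ * L / 4) * τ ≤ Real.exp (δ * (L - 76)) * Real.exp δ := by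
            gcongr
            linarith
        _ = _ := by
            rw [← Real.exp_add]
            ring_nf
    have h2 := mul_le_mul_of_nonneg_left h1 hDL.le
    have h3 : D / L * (1 + δ * L / 4) = D / L + D / 4 * δ := by
      field_simp
    have h4 : Real.exp (-(L - 75) / 2) ≤ 1 := Real.exp_le_one_iff.2 (by linarith)
    have h5 := mul_le_mul_of_nonneg_left h4 hDL.le
    have h6 : A * δ ≤ D / 4 * δ := by gcongr; linarith
    have h7 : A * τ = A + A * δ := by rw [hδ]; ring
    linarith

/-- The value `√(L / (π (1 + 75 / L)))`, `L = log l`, is a lower bound of the plateau of the Moser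
function. -/
theorem le_moser {l : ℕ} (hl : 2 ≤ l) {x : ℝ} (hx : |x| ≤ 1 / l) :
    Real.sqrt (Real.log l / (Real.pi * (1 + 75 / Real.log l))) ≤ moser l x := by
  have hL := log_natCast_pos hl
  have h0 := innerHalf_truncLog_pos hl
  rw [moser, truncLog_of_le hx, normHalf, Real.sqrt_div hL.le, Real.sqrt_mul Real.pi_pos.le,
    div_div]
  gcongr
  exact innerHalf_truncLog_le hl

theorem energy_lt_of_large {α₀ θ : ℝ} (hα₀ : 0 < α₀) (hθ : 2 < θ) {P Q f g : ℝ → ℝ}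
    (hP : IsWeight P) (hQ : IsWeight Q)
    (hf : IsNonlinearity α₀ θ f) (hg : IsNonlinearity α₀ θ g) {l : ℕ} (hl : 2 ≤ l) {c : ℝ}
    (hc : 0 < c) (hPc : ∀ x : ℝ, |x| ≤ 1 / l → c ≤ P x) (hQc : ∀ x : ℝ, |x| ≤ 1 / l → c ≤ Q x)
    {K s₀ : ℝ} (hK : 4 * (Real.pi / α₀) ≤ 2 * c * K * α₀ * Real.exp (-75))
    (hfK : ∀ s, s₀ ≤ s → K * Real.exp (α₀ * s ^ 2) / s ^ 2 ≤ primitive f s)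
    (hgK : ∀ s, s₀ ≤ s → K * Real.exp (α₀ * s ^ 2) / s ^ 2 ≤ primitive g s)
    (hL : 102 ≤ Real.log l) (hLs : s₀ ^ 2 ≤ (Real.log l - 75) / (2 * α₀))
    {t : ℝ} (ht : 0 ≤ t) {u : ℝ → ℝ} (hu : u ∈ HHalf) :
    energy P Q f g (t • (moser l, moser l) + (u, -u)) ≤
      max (Real.pi / α₀ / 2) (Real.pi / α₀ - 2 * c * K * α₀ * Real.exp (-75) / Real.log l *
        Real.exp (-(Real.log l - 75) / 2)) := by
  set L := Real.log l with hLdef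
  have hL0 : 0 < L := by linarith
  have hl0 : (0 : ℝ) < l := by positivity
  have hπ := Real.pi_pos
  set a := Real.sqrt (L / (Real.pi * (1 + 75 / L))) with ha
  have ha2 : a ^ 2 = L / (Real.pi * (1 + 75 / L)) := Real.sq_sqrt (by positivity)
  have hs (x : ℝ) (hx : |x| ≤ 1 / l) : t * a ≤ t * moser l x :=
    mul_le_mul_of_nonneg_left (le_moser hl hx) ht
  have hK0 : 0 < K := by
    have h1 : 0 < 2 * c * K * α₀ * Real.exp (-75) := lt_of_lt_of_le (by positivity) hK
    have h2 : 2 * c * K * α₀ * Real.exp (-75) = K * (2 * c * α₀ * Real.exp (-75)) := by ring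
    rw [h2] at h1
    exact pos_of_mul_pos_left h1 (by positivity)
  set τ := α₀ * t ^ 2 / Real.pi with hτ
  have ht2 : t ^ 2 = Real.pi / α₀ * τ := by
    rw [hτ]
    field_simp
  rcases le_or_gt τ (1 / 2) with h | h
  · refine le_trans ?_ (le_max_left _ _)
    -- `le_rfl` fixes `B = 0`: for `τ ≤ 1 / 2` the quadratic term alone suffices.
    have h1 := energy_le hα₀ hθ hP hQ hf hg hl hPc hQc hs le_rfl (hf.primitive_nonneg _)
      (hg.primitive_nonneg _) hu
    rw [mul_zero, mul_zero, sub_zero, ht2] at h1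
    refine h1.trans ?_
    rw [div_eq_mul_one_div _ (2 : ℝ)]
    gcongr
  · refine le_trans ?_ (le_max_right _ _)
    have hτ0 : 0 < τ := by linarith
    have hs2 : α₀ * (t * a) ^ 2 = τ * (L / (1 + 75 / L)) := by
      rw [mul_pow, ha2, hτ]
      field_simp
    have hq : L - 75 ≤ L / (1 + 75 / L) := by
      rw [le_div_iff₀ (by positivity)]
      have : (L - 75) * (1 + 75 / L) = L - 75 ^ 2 / L := by
        field_simp
        ring
      rw [this]
      have : 0 ≤ 75 ^ 2 / L := by positivity
      linarith
    have hq' : L / (1 + 75 / L) ≤ L := by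
      refine div_le_self hL0.le ?_
      have : 0 ≤ 75 / L := by positivity
      linarith
    have hlow : τ * (L - 75) ≤ α₀ * (t * a) ^ 2 := by
      rw [hs2]
      gcongr
    have hup : α₀ * (t * a) ^ 2 ≤ τ * L := by
      rw [hs2]
      gcongr
    have hta0 : 0 ≤ t * a := mul_nonneg ht (Real.sqrt_nonneg _)
    have hta2 : 0 < (t * a) ^ 2 := by
      have : 0 < τ * (L - 75) := mul_pos hτ0 (by linarith)
      exact pos_of_mul_pos_right (this.trans_le hlow) hα₀.le
    -- `τ > 1 / 2` gives `α₀ (t a)² ≥ (L - 75) / 2`, so the argument is large enough for the lower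
    -- bound on the primitives.
    have hs₀ : s₀ ≤ t * a := by
      refine le_of_sq_le_sq (hLs.trans ?_) hta0
      rw [div_le_iff₀ (by positivity)]
      nlinarith
    have h1 := energy_le hα₀ hθ hP hQ hf hg hl hPc hQc hs (by positivity) (hfK _ hs₀)
      (hgK _ hs₀) hu
    refine h1.trans (le_trans ?_ (mul_sub_exp_div_le (by positivity) hK hL h.le))
    rw [ht2]
    refine sub_le_sub_left ?_ _
    -- Since `l = e^L`, the measure `2 / l` of the plateau supplies the `-1` in the exponent, up to
    -- the factor `e^{75}` absorbed in the constant.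
    have e1 : Real.exp ((τ - 1) * (L - 75)) = Real.exp (τ * (L - 75)) * Real.exp 75 / l := by
      rw [← Real.exp_log hl0, ← Real.exp_add, ← Real.exp_sub, ← hLdef]
      ring_nf
    have e2 : 2 * c * K * α₀ * Real.exp (-75) / L *
        (Real.exp (τ * (L - 75)) * Real.exp 75 / l / τ) =
        2 / l * (c * (K * Real.exp (τ * (L - 75)) / (τ * L / α₀))) := by
      rw [Real.exp_neg]
      field_simp
    rw [e1, e2]
    gcongr
    rw [le_div_iff₀ hα₀, mul_comm]
    exact hup

end FracHamiltonian

end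

/-! ### Choice of the constants and conclusion -/

open FracHamiltonian in
theorem proposition3p3 (α₀ θ : ℝ) (hα₀ : 0 < α₀) (hθ : 2 < θ)
    (P Q f g : ℝ → ℝ)
    (hP : IsWeight P) (hQ : IsWeight Q)
    (hPQ : Real.sqrt (P 0 * Q 0) = 1)
    (hf : IsNonlinearity α₀ θ f) (hg : IsNonlinearity α₀ θ g) :
    ∃ l₀ : ℕ, ∀ l : ℕ, l₀ ≤ l →
      moser l ∈ HHalf ∧
      BddAbove (energy P Q f g '' halfSpace (moser l)) ∧
      sSup (energy P Q f g '' halfSpace (moser l)) < Real.pi / α₀ := by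
  have hPQ0 : P 0 * Q 0 = 1 := Real.sqrt_eq_one.1 hPQ
  have hP0 : 0 < P 0 := (hP.nonneg 0).lt_of_ne fun h => by simp [← h] at hPQ0
  have hQ0 : 0 < Q 0 := (hQ.nonneg 0).lt_of_ne fun h => by simp [← h] at hPQ0
  obtain ⟨c, hc, hcP, hcQ⟩ : ∃ c, 0 < c ∧ c < P 0 ∧ c < Q 0 := by
    obtain ⟨c, h1, h2⟩ := exists_between (lt_min hP0 hQ0)
    exact ⟨c, h1, lt_min_iff.1 h2⟩
  obtain ⟨δ, hδ, hδc⟩ := Metric.eventually_nhds_iff.1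
    ((hP.continuous.continuousAt.eventually_const_le hcP).and
      (hQ.continuous.continuousAt.eventually_const_le hcQ))
  have hπ := Real.pi_pos
  -- Chosen so that the constant `D` of `mul_sub_exp_div_le` is exactly `4 A`.
  set K := 4 * (Real.pi / α₀) / (2 * c * α₀ * Real.exp (-75)) with hK
  have hK0 : 0 < K := by positivity
  have hKc : 2 * c * K * α₀ * Real.exp (-75) = 4 * (Real.pi / α₀) := by
    rw [hK]
    field_simp
  obtain ⟨s₁, hs₁⟩ := hf.exists_le_primitive hα₀ hK0.le
  obtain ⟨s₂, hs₂⟩ := hg.exists_le_primitive hα₀ hK0.le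
  set s₀ := max s₁ s₂ with hs₀
  have hlog : Tendsto (fun l : ℕ => Real.log l) atTop atTop :=
    Real.tendsto_log_atTop.comp tendsto_natCast_atTop_atTop
  obtain ⟨l₀, hl₀⟩ := eventually_atTop.1
    (((eventually_ge_atTop 2).and ((hlog.eventually_ge_atTop 102).and
      (hlog.eventually_ge_atTop (75 + s₀ ^ 2 * (2 * α₀))))).and
      (tendsto_one_div_atTop_nhds_zero_nat.eventually_lt_const hδ))
  refine ⟨l₀, fun l hll => ?_⟩
  obtain ⟨⟨hl, hL, hLs⟩, hlδ⟩ := hl₀ l hll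
  have hclose (x : ℝ) (hx : |x| ≤ 1 / l) : c ≤ P x ∧ c ≤ Q x :=
    hδc (by rw [Real.dist_0_eq_abs]; exact hx.trans_lt hlδ)
  -- The bound involves neither `t` nor `u`, so the strict inequality survives the supremum.
  have hbound : ∀ y ∈ energy P Q f g '' halfSpace (moser l), y ≤
      max (Real.pi / α₀ / 2) (Real.pi / α₀ - 2 * c * K * α₀ * Real.exp (-75) / Real.log l *
        Real.exp (-(Real.log l - 75) / 2)) := by
    rintro _ ⟨_, ⟨t, ht, u, hu, rfl⟩, rfl⟩
    exact energy_lt_of_large hα₀ hθ hP hQ hf hg hl hc (fun x hx => (hclose x hx).1)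
      (fun x hx => (hclose x hx).2) hKc.ge (fun s hs => hs₁ s ((le_max_left _ _).trans hs))
      (fun s hs => hs₂ s ((le_max_right _ _).trans hs)) hL
      (by rw [le_div_iff₀ (by positivity)]; linarith) ht hu
  have hne : (energy P Q f g '' halfSpace (moser l)).Nonempty :=
    ⟨_, _, ⟨0, le_rfl, _, moser_mem_HHalf hl, rfl⟩, rfl⟩
  refine ⟨moser_mem_HHalf hl, ⟨_, hbound⟩, (csSup_le hne hbound).trans_lt (max_lt ?_ ?_)⟩
  · exact half_lt_self (by positivity)
  · exact sub_lt_self _ (by positivity)
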